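/- Let $p\ge 5$ be a prime and $0\le 2c\le p-3$. For $g\ge 1$ let $T_g^{(2c)}$ be the lollipop tree with loop edges $\ell_1,\dots,\ell_g$, stick edges $s_1,\dots,s_g$ and a path of edges $t_1,\dots,t_g$, where $t_1=s_1$ and $t_g$ is the trunk (free) edge; its trivalent vertices are those where $s_i$ meets the two ends of $\ell_i$ ($1\le i\le g$) and those where $t_i,s_{i+1},t_{i+1}$ meet ($1\le i\le g-1$). A coloring assigns to every edge a color in $\{0,1,\dots,p-2\}$ such that the trunk has color $2c$, each loop edge has color at most $(p-3)/2$, and any three colors $i,j,k$ meeting at a vertex satisfy $i+j+k\equiv 0 \pmod 2$, $|i-j|\le k\le i+j$ and $i+j+k\le 2p-4$. The stick edges then have even colors $2a_1,\dots,2a_g$, and the coloring is called even or odd according as $c+\sum_i a_i$ is even or odd. Let $\mathfrak e_g^{(2c)}$ and $\mathfrak o_g^{(2c)}$ be the numbers of even and of odd colorings, and $D_g^{(2c)}=\mathfrak e_g^{(2c)}+\mathfrak o_g^{(2c)}$. Let $B_n$ be the Bernoulli numbers, $\frac{t}{e^t-1}=\sum_{n\ge 0}B_n\frac{t^n}{n!}$.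 For every $g\ge 2$, each of $\mathfrak e_g^{(2c)}$, $\mathfrak o_g^{(2c)}$ and $D_g^{(2c)}$ is given, for all primes $p\ge5$ and all integers $c$ with $0\le 2c\le p-3$, by a polynomial with rational coefficients in $p$ and $c$ (depending only on $g$), and the polynomials for $\mathfrak e_g^{(2c)}$ and $\mathfrak o_g^{(2c)}$ have total degree exactly $3g-2$. Write $\equiv$ for equality up to addition of a polynomial in $p$ and $c$ of total degree $\le 3g-4$. For $g\ge 3$, $$\mathfrak e_g^{(2c)}\equiv \mathfrak o_g^{(2c)}\equiv \frac{(-1)^g}{4}\sum_{k=0}^{2g-2}\frac{B_k}{k!}\,\frac{c^{2g-2-k}}{(2g-2-k)!}\left(1+\frac{2c}{2g-1-k}\right)p^{g-1+k},$$ and, for all $g\ge 2$, $\tfrac12 D_g^{(2c)}$ is $\equiv$ to the same right-hand side. -/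

import Mathlib

/-- Colors `i`, `j`, `k` may meet at a trivalent vertex: their sum is even, they satisfy the
triangle inequalities `|i - j| ≤ k ≤ i + j`, and `i + j + k ≤ 2p - 4`. -/
def Admissible (p i j k : ℕ) : Prop :=
  Even (i + j + k) ∧ i ≤ j + k ∧ j ≤ i + k ∧ k ≤ i + j ∧ i + j + k + 4 ≤ 2 * p

/-- Small admissible colorings of the genus `g` lollipop tree (`1 ≤ g`) with trunk color `2c`.
The tree has `g` loop edges `ℓ 0, …, ℓ (g-1)`, the stick edges `s 0, …, s (g-1)` that end at the
corresponding loops, and a path of edges `t 0, …, t (g-1)`, where `t 0` is the stick `s 0`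
itself, `t (g-1)` is the trunk, and the edges `t i`, `s (i+1)`, `t (i+1)` meet at a
trivalent vertex for `0 ≤ i < g - 1`. Each loop edge meets its stick in a trivalent vertex and
is incident to that vertex twice. All colors lie in `{0, …, p-2}`; a coloring is small when the
colors of the loop edges are at most `(p-3)/2`. -/
def IsColoring (g p c : ℕ) (loop stick path : Fin g → ℕ) : Prop :=
  (∀ i, loop i < p - 1 ∧ stick i < p - 1 ∧ path i < p - 1) ∧
  (∀ i, Admissible p (stick i) (loop i) (loop i)) ∧
  (∀ i, 2 * loop i + 3 ≤ p) ∧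
  (∀ i : Fin g, (i : ℕ) = 0 → path i = stick i) ∧
  (∀ i j : Fin g, (j : ℕ) = i + 1 → Admissible p (path i) (stick j) (path j)) ∧
  (∀ i : Fin g, (i : ℕ) + 1 = g → path i = 2 * c)

/-- The number `c + a₁ + ⋯ + a_g` whose parity is the parity of the coloring; the stick colors
are the even numbers `2aᵢ`. -/
def coloringWeight {g : ℕ} (c : ℕ) (stick : Fin g → ℕ) : ℕ :=
  c + ∑ i, stick i / 2

/-- `𝔢_g^{(2c)}`, the number of even colorings of the lollipop tree. -/
noncomputable def evenCount (g p c : ℕ) : ℕ :=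
  Set.ncard {σ : (Fin g → ℕ) × (Fin g → ℕ) × (Fin g → ℕ) |
    IsColoring g p c σ.1 σ.2.1 σ.2.2 ∧ Even (coloringWeight c σ.2.1)}

/-- `𝔬_g^{(2c)}`, the number of odd colorings of the lollipop tree. -/
noncomputable def oddCount (g p c : ℕ) : ℕ :=
  Set.ncard {σ : (Fin g → ℕ) × (Fin g → ℕ) × (Fin g → ℕ) |
    IsColoring g p c σ.1 σ.2.1 σ.2.2 ∧ Odd (coloringWeight c σ.2.1)}

/-- `D_g^{(2c)} = 𝔢_g^{(2c)} + 𝔬_g^{(2c)}`. -/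
noncomputable def totalCount (g p c : ℕ) : ℕ :=
  evenCount g p c + oddCount g p c

/-- The polynomial `P` in the variables `p = X 0` and `c = X 1` gives the value of `f p c` for
all primes `p ≥ 5` and all `c` with `0 ≤ 2c ≤ p - 3`. -/
def GivenByPolynomial (f : ℕ → ℕ → ℕ) (P : MvPolynomial (Fin 2) ℚ) : Prop :=
  ∀ p c : ℕ, p.Prime → 5 ≤ p → 2 * c + 3 ≤ p →
    (f p c : ℚ) = MvPolynomial.eval ![(p : ℚ), (c : ℚ)] P

/-- The polynomial
`((-1)^g / 4) ∑_{k=0}^{2g-2} (B_k / k!) (c^{2g-2-k} / (2g-2-k)!) (1 + 2c/(2g-1-k)) p^{g-1+k}`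
in `p = X 0` and `c = X 1`, where `B_k` is the Bernoulli number with `B_1 = -1/2`. -/
noncomputable def leadingPart (g : ℕ) : MvPolynomial (Fin 2) ℚ :=
  MvPolynomial.C ((-1 : ℚ) ^ g / 4) *
    ∑ k ∈ Finset.range (2 * g - 1),
      MvPolynomial.C (bernoulli k / (k.factorial : ℚ)) *
        (MvPolynomial.C (1 / ((2 * g - 2 - k).factorial : ℚ)) *
          MvPolynomial.X 1 ^ (2 * g - 2 - k)) *
        (1 + MvPolynomial.C (2 / (2 * (g : ℚ) - 1 - (k : ℚ))) * MvPolynomial.X 1) *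
        MvPolynomial.X 0 ^ (g - 1 + k)

/-!
Write `p = 2N + 1`. Cutting off the last loop expresses the counts of genus `g + 1` by those of
genus `g`: a coloring is determined by the color `2b` of the next path edge, the last stick color
`2a` and one of `N - a` loop colors. Summed over the admissible `a`, with or without the sign
`(-1) ^ (a + b + c)`, the factors `N - a` collapse to simple kernels. For the total count `𝔢 + 𝔬`
the kernel is `(2 min(b, c) + 1) (N - max(b, c))`, for the signed count `𝔢 - 𝔬` it is
`N - max(b, c)` (`totalSum_add_two`, `signedSum_add_two`).

Both kernels are Green functions of the second difference operator in `c`. In terms of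
`u = c + 1/2`, summation by parts therefore expresses the image of `u ^ n` by a polynomial `E`
whose second difference is `u ^ n` (`exists_second_antidifference`). Hence both recursions map
polynomials in `p` and `u` to polynomials, and raise the total degree by at most `3` and `2`
respectively (`exists_transforms_totalOp`, `exists_transforms_signedOp`). The signed count of
genus `g` thus has degree at most `2g - 1`. This is at most `3g - 4` for `g ≥ 3`, and at most
`3g - 3` for `g = 2`, so it does not affect the leading terms.

Since `E` agrees with `u ^ (n + 2) / ((n + 1) (n + 2))` up to degree `n`, the total recursion is,
up to terms whose degree is lower by two, the solution of the boundary value problem `F'' = -p f`,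
`F(0) = F(p/2) = 0`. Starting from `p/2 - u` in genus one, this problem is solved by multiples of
the Bernoulli polynomials `B_{2g-1}(u/p)`; the boundary condition at `p/2` is the vanishing of
`B_{2g+1}(1/2)` (`sum_bernoulli_half`, `bernoulliPart_succ`). Substituting `u = c + 1/2` and
keeping two orders yields the stated leading part
(`totalDegree_shiftHalf_bernoulliPart_sub_le`).
-/

/-! ### Counting colorings by cutting off the last loop -/

/-- Colorings with trunk color `2c` whose weight has the parity of `e`. -/
def coloringsOfParity (g p c e : ℕ) : Set ((Fin g → ℕ) × (Fin g → ℕ) × (Fin g → ℕ)) :=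
  {σ | IsColoring g p c σ.1 σ.2.1 σ.2.2 ∧ Even (coloringWeight c σ.2.1 + e)}

/-- The halves `b`, `a`, `c` of three even colors satisfy the admissibility condition
for `p = 2N + 1`. -/
def HalfAdmissible (N b a c : ℕ) : Prop :=
  b ≤ a + c ∧ a ≤ b + c ∧ c ≤ b + a ∧ a + b + c + 1 ≤ 2 * N

instance (N b a c : ℕ) : Decidable (HalfAdmissible N b a c) := by
  unfold HalfAdmissible; infer_instance

theorem admissible_two_mul_iff (N b a c : ℕ) :
    Admissible (2 * N + 1) (2 * b) (2 * a) (2 * c) ↔ HalfAdmissible N b a c := by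
  unfold Admissible HalfAdmissible
  constructor
  · rintro ⟨-, h⟩; omega
  · intro h
    exact ⟨⟨b + a + c, by omega⟩, by omega⟩

theorem coloringsOfParity_finite (g p c e : ℕ) : (coloringsOfParity g p c e).Finite := by
  have hf : (Set.univ.pi fun _ : Fin g => Set.Iio p).Finite :=
    Set.Finite.pi fun _ => Set.finite_Iio p
  refine (hf.prod (hf.prod hf)).subset fun σ hσ => ?_
  have h := hσ.1.1
  simp only [Set.mem_prod, Set.mem_pi, Set.mem_univ, true_implies, Set.mem_Iio]
  refine ⟨fun i => ?_, fun i => ?_, fun i => ?_⟩ <;> have := h i <;> omega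

theorem isColoring_snoc_iff (m N c b a l : ℕ) (hc : c < N)
    (loop stick path : Fin (m + 1) → ℕ) :
    (IsColoring (m + 2) (2 * N + 1) c (Fin.snoc (α := fun _ => ℕ) loop l)
        (Fin.snoc (α := fun _ => ℕ) stick (2 * a)) (Fin.snoc (α := fun _ => ℕ) path (2 * c)) ∧
      path (Fin.last m) = 2 * b) ↔
    (IsColoring (m + 1) (2 * N + 1) b loop stick path ∧
      a ≤ l ∧ l < N ∧ HalfAdmissible N b a c) := by
  rw [← admissible_two_mul_iff]
  unfold IsColoring
  constructor
  · rintro ⟨⟨h1, h2, h3, h4, h5, h6⟩, h7⟩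
    refine ⟨⟨fun i => ?_, fun i => ?_, fun i => ?_, fun i hi => ?_, fun i j hij => ?_,
      fun i hi => ?_⟩, ?_, ?_, ?_⟩
    · simpa using h1 i.castSucc
    · simpa using h2 i.castSucc
    · simpa using h3 i.castSucc
    · simpa using h4 i.castSucc hi
    · simpa using h5 i.castSucc j.castSucc hij
    · rw [← h7]; congr 1; ext; simp at hi ⊢; omega
    · have := h2 (Fin.last (m + 1))
      simp [Admissible] at this; omega
    · have := h3 (Fin.last (m + 1))
      simp at this; omega
    · have := h5 (Fin.last m).castSucc (Fin.last (m + 1)) (by simp)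
      simpa [h7] using this
  · rintro ⟨⟨h1, h2, h3, h4, h5, h6⟩, hal, hl, hT⟩
    have h7 : path (Fin.last m) = 2 * b := h6 _ (by simp)
    refine ⟨⟨fun i => ?_, fun i => ?_, fun i => ?_, fun i hi => ?_, fun i j hij => ?_,
      fun i hi => ?_⟩, h7⟩
    · induction i using Fin.lastCases with
      | last => simp; omega
      | cast i => simpa using h1 i
    · induction i using Fin.lastCases with
      | last =>
        simp only [Fin.snoc_last, Admissible]
        exact ⟨⟨a + l, by omega⟩, by omega⟩
      | cast i => simpa using h2 i
    · induction i using Fin.lastCases with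
      | last => simp; omega
      | cast i => simpa using h3 i
    · induction i using Fin.lastCases with
      | last => simp at hi
      | cast i => simpa using h4 i hi
    · induction i using Fin.lastCases with
      | last => have := j.2; simp at hij; omega
      | cast i =>
        induction j using Fin.lastCases with
        | last =>
          have : i = Fin.last m := by ext; simp at hij ⊢; omega
          subst this
          simpa [h7] using hT
        | cast j => simpa using h5 i j hij
    · have : i = Fin.last (m + 1) := by ext; simp at hi ⊢; omega
      subst this; simp

/-- Attach a loop of color `l` on a stick of color `2a` to a coloring, with new trunk color
`2c`. -/
def attachLoop {m : ℕ} (c a l : ℕ) (σ : (Fin m → ℕ) × (Fin m → ℕ) × (Fin m → ℕ)) :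
    (Fin (m + 1) → ℕ) × (Fin (m + 1) → ℕ) × (Fin (m + 1) → ℕ) :=
  (Fin.snoc (α := fun _ => ℕ) σ.1 l, Fin.snoc (α := fun _ => ℕ) σ.2.1 (2 * a),
    Fin.snoc (α := fun _ => ℕ) σ.2.2 (2 * c))

theorem attachLoop_injective {m : ℕ} (c a l : ℕ) :
    Function.Injective (attachLoop (m := m) c a l) := by
  rintro ⟨x, y, z⟩ ⟨x', y', z'⟩ h
  simp only [attachLoop, Prod.mk.injEq] at h
  obtain ⟨h1, h2, h3⟩ := h
  rw [Fin.snoc_injective2 h1 |>.1, Fin.snoc_injective2 h2 |>.1, Fin.snoc_injective2 h3 |>.1]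

/-- A coloring of genus `m + 2` is a coloring of genus `m + 1` with some trunk color `2b`, together
with the last stick color `2a` and the last loop color `l`. There are `N - a` possible values of
`l`, namely `a ≤ l < N`. -/
theorem ncard_coloringsOfParity_add_two (m N c e : ℕ) (hc : c < N) :
    (coloringsOfParity (m + 2) (2 * N + 1) c e).ncard =
      ∑ b ∈ Finset.range N, ∑ a ∈ Finset.range N with HalfAdmissible N b a c,
        (N - a) * (coloringsOfParity (m + 1) (2 * N + 1) b (e + a + b + c)).ncard := by
  classical
  set T := (coloringsOfParity_finite (m + 2) (2 * N + 1) c e).toFinset with hT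
  let key : ((Fin (m + 2) → ℕ) × (Fin (m + 2) → ℕ) × (Fin (m + 2) → ℕ)) → ℕ × ℕ × ℕ :=
    fun σ => (σ.2.2 (Fin.last m).castSucc / 2, σ.2.1 (Fin.last (m + 1)) / 2,
      σ.1 (Fin.last (m + 1)))
  -- The codomain of `key` has no admissibility condition: inadmissible keys have empty fibers.
  have hmaps : ∀ σ ∈ T, key σ ∈ Finset.range N ×ˢ Finset.range N ×ˢ Finset.range N := by
    intro σ hσ
    rw [hT, Set.Finite.mem_toFinset] at hσ
    obtain ⟨h1, h2, h3, -⟩ := hσ.1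
    have a1 := h1 (Fin.last m).castSucc
    have a2 := h1 (Fin.last (m + 1))
    have a3 := h3 (Fin.last (m + 1))
    simp only [key, Finset.mem_product, Finset.mem_range]
    omega
  have hfib : ∀ b ∈ Finset.range N, ∀ a ∈ Finset.range N, ∀ l ∈ Finset.range N,
      (T.filter fun σ => key σ = (b, a, l)).card =
        if a ≤ l ∧ HalfAdmissible N b a c then
          (coloringsOfParity (m + 1) (2 * N + 1) b (e + a + b + c)).ncard else 0 := by
    intro b hb a ha l hl
    rw [Finset.mem_range] at hb ha hl
    have himg : ((T.filter fun σ => key σ = (b, a, l) : Finset _) : Set _) =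
        attachLoop c a l '' {σ | σ ∈ coloringsOfParity (m + 1) (2 * N + 1) b (e + a + b + c) ∧
          a ≤ l ∧ HalfAdmissible N b a c} := by
      ext σ
      simp only [Finset.coe_filter, hT, Set.Finite.mem_toFinset, Set.mem_ofPred_eq, Set.mem_image]
      constructor
      · rintro ⟨⟨hcol, hpar⟩, hkey⟩
        simp only [key, Prod.mk.injEq] at hkey
        obtain ⟨k1, k2, k3⟩ := hkey
        obtain ⟨x, y, z⟩ := σ
        obtain ⟨h1, h2, h3, h4, h5, h6⟩ := id hcol
        have hz : z (Fin.last (m + 1)) = 2 * c := h6 _ (by simp)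
        have hy : y (Fin.last (m + 1)) = 2 * a := by
          obtain ⟨r, hr⟩ := (h2 (Fin.last (m + 1))).1
          simp only at hr k2
          omega
        have hzb : z (Fin.last m).castSucc = 2 * b := by
          obtain ⟨r, hr⟩ := (h5 (Fin.last m).castSucc (Fin.last (m + 1)) (by simp)).1
          simp only at hr k1
          omega
        have ex : Fin.snoc (α := fun _ => ℕ) (Fin.init x) l = x := by
          rw [← k3]; exact Fin.snoc_init_self x
        have ey : Fin.snoc (α := fun _ => ℕ) (Fin.init y) (2 * a) = y := by
          rw [← hy]; exact Fin.snoc_init_self y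
        have ez : Fin.snoc (α := fun _ => ℕ) (Fin.init z) (2 * c) = z := by
          rw [← hz]; exact Fin.snoc_init_self z
        have := (isColoring_snoc_iff m N c b a l hc (Fin.init x) (Fin.init y)
          (Fin.init z)).1 ⟨by rw [ex, ey, ez]; exact hcol, hzb⟩
        refine ⟨(Fin.init x, Fin.init y, Fin.init z), ⟨⟨this.1, ?_⟩, this.2.1, this.2.2.2⟩, ?_⟩
        · rw [coloringWeight, Fin.sum_univ_castSucc] at hpar
          simp only [hy] at hpar
          simp only [coloringWeight, Fin.init]
          rw [Nat.even_iff] at hpar ⊢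
          omega
        · simp only [attachLoop, ex, ey, ez]
      · rintro ⟨⟨x, y, z⟩, ⟨⟨hcol, hpar⟩, hal, hadm⟩, rfl⟩
        have := (isColoring_snoc_iff m N c b a l hc x y z).2 ⟨hcol, hal, hl, hadm⟩
        refine ⟨⟨this.1, ?_⟩, ?_⟩
        · rw [coloringWeight, Fin.sum_univ_castSucc]
          simp only [attachLoop, Fin.snoc_castSucc, Fin.snoc_last]
          simp only [coloringWeight] at hpar
          rw [Nat.even_iff] at hpar ⊢
          omega
        · simp [key, attachLoop, this.2]
    rw [← Set.ncard_coe_finset, himg, Set.ncard_image_of_injective _ (attachLoop_injective c a l)]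
    split_ifs with h
    · congr 1; ext σ; simp [h]
    · have : {σ | σ ∈ coloringsOfParity (m + 1) (2 * N + 1) b (e + a + b + c) ∧
          a ≤ l ∧ HalfAdmissible N b a c} = ∅ := by
        ext σ; simp only [Set.mem_ofPred_eq, Set.mem_empty_iff_false, iff_false]
        exact fun h' => h h'.2
      rw [this, Set.ncard_empty]
  rw [Set.ncard_eq_toFinset_card _ (coloringsOfParity_finite (m + 2) (2 * N + 1) c e), ← hT,
    Finset.card_eq_sum_card_fiberwise hmaps, Finset.sum_product]
  refine Finset.sum_congr rfl fun b hb => ?_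
  rw [Finset.sum_product, Finset.sum_filter]
  refine Finset.sum_congr rfl fun a ha => ?_
  rw [Finset.sum_congr rfl (hfib b hb a ha)]
  have hcard : (Finset.range N).filter (fun l => a ≤ l) = Finset.Ico a N := by
    ext l; simp; omega
  split_ifs with h
  · simp only [h, and_true]
    rw [← Finset.sum_filter, hcard, Finset.sum_const, Nat.card_Ico, smul_eq_mul]
  · simp [h]

theorem ncard_coloringsOfParity_one (N c e : ℕ) (hc : c < N) :
    (coloringsOfParity 1 (2 * N + 1) c e).ncard = if Even e then N - c else 0 := by
  have himg : coloringsOfParity 1 (2 * N + 1) c e =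
      (fun l : ℕ => ((fun _ => l, fun _ => 2 * c, fun _ => 2 * c) :
        (Fin 1 → ℕ) × (Fin 1 → ℕ) × (Fin 1 → ℕ))) '' {l | l ∈ Set.Ico c N ∧ Even e} := by
    ext ⟨x, y, z⟩
    simp only [coloringsOfParity, coloringWeight, IsColoring, Set.mem_ofPred_eq, Set.mem_image,
      Prod.mk.injEq, Set.mem_Ico]
    constructor
    · rintro ⟨⟨h1, h2, h3, h4, h5, h6⟩, hpar⟩
      have hz : z 0 = 2 * c := h6 0 rfl
      have hy : y 0 = 2 * c := by rw [← h4 0 rfl, hz]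
      have a2 := h2 0
      have a3 := h3 0
      refine ⟨x 0, ⟨?_, ?_⟩, ?_, ?_, ?_⟩
      · simp only [Admissible, hy] at a2; omega
      · simp only [Finset.univ_unique, Fin.default_eq_zero, Finset.sum_singleton, hy] at hpar
        rw [Nat.even_iff] at hpar ⊢; omega
      all_goals
        funext i
        obtain rfl : i = 0 := Subsingleton.elim i 0
        first | rfl | exact hy.symm | exact hz.symm
    · rintro ⟨l, ⟨hl, he⟩, rfl, rfl, rfl⟩
      refine ⟨⟨fun i => by dsimp only; omega, fun i => ?_, fun i => by dsimp only; omega,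
        fun i _ => rfl, fun i j hij => by have := j.2; omega, fun i _ => rfl⟩, ?_⟩
      · exact ⟨⟨c + l, by dsimp only; omega⟩, by dsimp only; omega⟩
      · simp only [Finset.univ_unique, Finset.sum_const, Finset.card_singleton, one_smul]
        rw [Nat.even_iff] at he ⊢; omega
  rw [himg, Set.ncard_image_of_injective]
  · split_ifs with h
    · simp only [h, and_true]
      change (Set.Ico c N).ncard = _
      rw [← Finset.coe_Ico, Set.ncard_coe_finset, Nat.card_Ico]
    · simp [h]
  · intro l l' h
    exact congrFun (congrArg Prod.fst h) 0

/-! ### Total and signed counts satisfy linear recursions -/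

theorem coloringsOfParity_congr (g p c : ℕ) {e e' : ℕ} (h : Even e ↔ Even e') :
    coloringsOfParity g p c e = coloringsOfParity g p c e' := by
  unfold coloringsOfParity
  simp only [Nat.even_add, h]

/-- `𝔢_g^{(2c)} + 𝔬_g^{(2c)}` for `p = 2N + 1`, as a rational number. -/
noncomputable def totalSum (g N c : ℕ) : ℚ :=
  (coloringsOfParity g (2 * N + 1) c 0).ncard + (coloringsOfParity g (2 * N + 1) c 1).ncard

/-- `𝔢_g^{(2c)} - 𝔬_g^{(2c)}` for `p = 2N + 1`. -/
noncomputable def signedSum (g N c : ℕ) : ℚ :=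
  (coloringsOfParity g (2 * N + 1) c 0).ncard - (coloringsOfParity g (2 * N + 1) c 1).ncard

theorem ncard_add_ncard_succ (g N c e : ℕ) :
    ((coloringsOfParity g (2 * N + 1) c e).ncard : ℚ) +
      (coloringsOfParity g (2 * N + 1) c (1 + e)).ncard = totalSum g N c := by
  unfold totalSum
  rcases Nat.even_or_odd e with h | h
  · rw [coloringsOfParity_congr g _ c (e := e) (e' := 0) (by simp [h]),
      coloringsOfParity_congr g _ c (e := 1 + e) (e' := 1) (by simp [h, Nat.even_add])]
  · rw [coloringsOfParity_congr g _ c (e := e) (e' := 1) (by simpa using h),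
      coloringsOfParity_congr g _ c (e := 1 + e) (e' := 0)
        (by simp [Nat.even_add, Nat.not_even_iff_odd.2 h]), add_comm]

theorem ncard_sub_ncard_succ (g N c e : ℕ) :
    ((coloringsOfParity g (2 * N + 1) c e).ncard : ℚ) -
      (coloringsOfParity g (2 * N + 1) c (1 + e)).ncard = (-1) ^ e * signedSum g N c := by
  unfold signedSum
  rcases Nat.even_or_odd e with h | h
  · rw [coloringsOfParity_congr g _ c (e := e) (e' := 0) (by simp [h]),
      coloringsOfParity_congr g _ c (e := 1 + e) (e' := 1) (by simp [h, Nat.even_add]),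
      h.neg_one_pow, one_mul]
  · rw [coloringsOfParity_congr g _ c (e := e) (e' := 1) (by simpa using h),
      coloringsOfParity_congr g _ c (e := 1 + e) (e' := 0)
        (by simp [Nat.even_add, Nat.not_even_iff_odd.2 h]), h.neg_one_pow]
    ring

theorem totalSum_one (N c : ℕ) (hc : c < N) : totalSum 1 N c = N - c := by
  simp [totalSum, ncard_coloringsOfParity_one N c _ hc, Nat.cast_sub hc.le]

theorem signedSum_one (N c : ℕ) (hc : c < N) : signedSum 1 N c = N - c := by
  simp [signedSum, ncard_coloringsOfParity_one N c _ hc, Nat.cast_sub hc.le]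

/-- The stick colors `2a` compatible with `b ≤ c` form an interval starting at `a = c - b`; its upper
end is `b + c` or `2N - 1 - b - c`. -/
theorem sum_halfAdmissible (N b c : ℕ) (hbc : b ≤ c) (hc : c < N) (f : ℕ → ℚ) :
    ∑ a ∈ Finset.range N with HalfAdmissible N b a c, f a =
      ∑ i ∈ Finset.range (if b + c < N then 2 * b + 1 else 2 * (N - c)), f (c - b + i) := by
  have hset : (Finset.range N).filter (fun a => HalfAdmissible N b a c) =
      Finset.Ico (c - b) (c - b + if b + c < N then 2 * b + 1 else 2 * (N - c)) := by
    ext a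
    rw [Finset.mem_filter, Finset.mem_range, Finset.mem_Ico, HalfAdmissible]
    split_ifs <;> omega
  rw [hset, Finset.sum_Ico_eq_sum_range, Nat.add_sub_cancel_left]

theorem sum_range_sub_cast (x : ℚ) (n : ℕ) :
    ∑ i ∈ Finset.range n, (x - i) = n * x - n * (n - 1) / 2 := by
  induction n with
  | zero => simp
  | succ n ih => rw [Finset.sum_range_succ, ih]; push_cast; ring

theorem sum_range_two_mul_neg_one_pow (x : ℚ) (n : ℕ) :
    ∑ i ∈ Finset.range (2 * n), (-1 : ℚ) ^ i * (x - i) = n := by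
  induction n with
  | zero => simp
  | succ n ih =>
    rw [Nat.mul_succ, Finset.sum_range_succ, Finset.sum_range_succ, ih, pow_succ,
      (even_two_mul n).neg_one_pow]
    push_cast; ring

/-- The two cases `b + c < N` and `N ≤ b + c` have different ranges of summation
but give the same value. -/
theorem sum_halfAdmissible_sub (N b c : ℕ) (hbc : b ≤ c) (hc : c < N) :
    ∑ a ∈ Finset.range N with HalfAdmissible N b a c, ((N : ℚ) - a) =
      (2 * b + 1) * (N - c) := by
  have key : ∀ n : ℕ, ∑ i ∈ Finset.range n, ((N : ℚ) - (c - b + i : ℕ)) =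
      n * (N - c + b) - n * (n - 1) / 2 := by
    intro n
    rw [← sum_range_sub_cast]
    refine Finset.sum_congr rfl fun i _ => ?_
    rw [Nat.cast_add, Nat.cast_sub hbc]; ring
  rw [sum_halfAdmissible N b c hbc hc, key]
  split_ifs
  · push_cast; ring
  · rw [Nat.cast_mul, Nat.cast_sub hc.le]; push_cast; ring

theorem sum_halfAdmissible_neg_one_pow (N b c : ℕ) (hbc : b ≤ c) (hc : c < N) :
    ∑ a ∈ Finset.range N with HalfAdmissible N b a c, (-1 : ℚ) ^ (a + b + c) * (N - a) =
      N - c := by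
  have key : ∀ n : ℕ, ∑ i ∈ Finset.range n,
      (-1 : ℚ) ^ (c - b + i + b + c) * ((N : ℚ) - (c - b + i : ℕ)) =
      ∑ i ∈ Finset.range n, (-1 : ℚ) ^ i * ((N - c + b : ℚ) - i) := by
    intro n
    refine Finset.sum_congr rfl fun i _ => ?_
    have h1 : c - b + i + b + c = 2 * c + i := by omega
    rw [h1, pow_add, (even_two_mul c).neg_one_pow, Nat.cast_add, Nat.cast_sub hbc]; ring
  rw [sum_halfAdmissible N b c hbc hc, key]
  split_ifs
  · rw [Finset.sum_range_succ, sum_range_two_mul_neg_one_pow, (even_two_mul b).neg_one_pow]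
    push_cast; ring
  · rw [sum_range_two_mul_neg_one_pow, Nat.cast_sub hc.le]

theorem halfAdmissible_comm (N b a c : ℕ) : HalfAdmissible N b a c ↔ HalfAdmissible N c a b := by
  unfold HalfAdmissible; omega

theorem sum_range_eq_split (N c : ℕ) (hc : c < N) (f h : ℕ → ℚ) (u : ℕ → ℕ → ℚ)
    (h1 : ∀ b < c, f b = u b c) (h2 : ∀ b, c ≤ b → b < N → f b = h b) :
    ∑ b ∈ Finset.range N, f b =
      ∑ b ∈ Finset.range c, u b c + ∑ b ∈ Finset.Ico c N, h b := by
  rw [Finset.range_eq_Ico, ← Finset.sum_Ico_consecutive f (Nat.zero_le c) hc.le,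
    Finset.range_eq_Ico]
  congr 1
  · exact Finset.sum_congr rfl fun b hb => h1 b (Finset.mem_Ico.1 hb).2
  · exact Finset.sum_congr rfl fun b hb => h2 b (Finset.mem_Ico.1 hb).1 (Finset.mem_Ico.1 hb).2

theorem totalSum_add_two (m N c : ℕ) (hc : c < N) :
    totalSum (m + 2) N c =
      (N - c) * ∑ b ∈ Finset.range c, (2 * b + 1) * totalSum (m + 1) N b +
      (2 * c + 1) * ∑ b ∈ Finset.Ico c N, (N - b) * totalSum (m + 1) N b := by
  have hsum : totalSum (m + 2) N c = ∑ b ∈ Finset.range N,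
      (∑ a ∈ Finset.range N with HalfAdmissible N b a c, ((N : ℚ) - a)) *
        totalSum (m + 1) N b := by
    rw [totalSum, ncard_coloringsOfParity_add_two m N c _ hc,
      ncard_coloringsOfParity_add_two m N c _ hc, Nat.cast_sum, Nat.cast_sum,
      ← Finset.sum_add_distrib]
    refine Finset.sum_congr rfl fun b _ => ?_
    rw [Nat.cast_sum, Nat.cast_sum, ← Finset.sum_add_distrib, Finset.sum_mul]
    refine Finset.sum_congr rfl fun a ha => ?_
    have ha' : a ≤ N := (Finset.mem_range.1 (Finset.mem_filter.1 ha).1).le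
    rw [← ncard_add_ncard_succ (m + 1) N b (0 + a + b + c), Nat.cast_mul, Nat.cast_mul,
      Nat.cast_sub ha', show 1 + (0 + a + b + c) = 1 + a + b + c by ring]
    ring
  rw [hsum, sum_range_eq_split N c hc _
    (fun b => (2 * c + 1) * ((N - b) * totalSum (m + 1) N b))
    (fun b c => (N - c) * ((2 * b + 1) * totalSum (m + 1) N b)) ?_ ?_,
    Finset.mul_sum, Finset.mul_sum]
  · intro b hb
    rw [sum_halfAdmissible_sub N b c hb.le hc]; ring
  · intro b hb hbN
    simp only [halfAdmissible_comm N b _ c]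
    rw [sum_halfAdmissible_sub N c b hb hbN]; ring

theorem signedSum_add_two (m N c : ℕ) (hc : c < N) :
    signedSum (m + 2) N c =
      (N - c) * ∑ b ∈ Finset.range c, signedSum (m + 1) N b +
      ∑ b ∈ Finset.Ico c N, (N - b) * signedSum (m + 1) N b := by
  have hsum : signedSum (m + 2) N c = ∑ b ∈ Finset.range N,
      (∑ a ∈ Finset.range N with HalfAdmissible N b a c, (-1 : ℚ) ^ (a + b + c) * (N - a)) *
        signedSum (m + 1) N b := by
    rw [signedSum, ncard_coloringsOfParity_add_two m N c _ hc,
      ncard_coloringsOfParity_add_two m N c _ hc, Nat.cast_sum, Nat.cast_sum,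
      ← Finset.sum_sub_distrib]
    refine Finset.sum_congr rfl fun b _ => ?_
    rw [Nat.cast_sum, Nat.cast_sum, ← Finset.sum_sub_distrib, Finset.sum_mul]
    refine Finset.sum_congr rfl fun a ha => ?_
    have ha' : a ≤ N := (Finset.mem_range.1 (Finset.mem_filter.1 ha).1).le
    have h := ncard_sub_ncard_succ (m + 1) N b (0 + a + b + c)
    rw [show 1 + (0 + a + b + c) = 1 + a + b + c by ring] at h
    rw [zero_add] at h ⊢
    rw [Nat.cast_mul, Nat.cast_mul, Nat.cast_sub ha', mul_right_comm, ← h]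
    ring
  rw [hsum, sum_range_eq_split N c hc _
    (fun b => (N - b) * signedSum (m + 1) N b)
    (fun b c => (N - c) * signedSum (m + 1) N b) ?_ ?_, Finset.mul_sum]
  · intro b hb
    rw [sum_halfAdmissible_neg_one_pow N b c hb.le hc]
  · intro b hb hbN
    simp only [halfAdmissible_comm N b _ c]
    have : ∀ a, a + b + c = a + c + b := fun a => by ring
    simp only [this]
    rw [sum_halfAdmissible_neg_one_pow N c b hb hbN]

theorem evenCount_eq (g N c : ℕ) :
    (evenCount g (2 * N + 1) c : ℚ) = (totalSum g N c + signedSum g N c) / 2 := by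
  have : evenCount g (2 * N + 1) c = (coloringsOfParity g (2 * N + 1) c 0).ncard := rfl
  rw [this, totalSum, signedSum]; ring

theorem oddCount_eq (g N c : ℕ) :
    (oddCount g (2 * N + 1) c : ℚ) = (totalSum g N c - signedSum g N c) / 2 := by
  have : oddCount g (2 * N + 1) c = (coloringsOfParity g (2 * N + 1) c 1).ncard := by
    simp only [oddCount, coloringsOfParity, Nat.even_add_one, Nat.not_even_iff_odd]
  rw [this, totalSum, signedSum]; ring

/-! ### Summation by parts -/

theorem sum_range_two_mul_add_one_mul_second_difference (e : ℕ → ℚ) (c : ℕ) :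
    ∑ b ∈ Finset.range c, (2 * (b : ℚ) + 1) * (e (b + 2) - 2 * e (b + 1) + e b) =
      (2 * c - 1) * e (c + 1) - (2 * c + 1) * e c + (e 1 + e 0) := by
  induction c with
  | zero => simp
  | succ c ih => rw [Finset.sum_range_succ, ih]; push_cast; ring

theorem sum_range_second_difference (e : ℕ → ℚ) (c : ℕ) :
    ∑ b ∈ Finset.range c, (e (b + 2) - 2 * e (b + 1) + e b) =
      e (c + 1) - e c - (e 1 - e 0) := by
  induction c with
  | zero => simp
  | succ c ih => rw [Finset.sum_range_succ, ih]; ring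

theorem sum_Ico_sub_mul_second_difference (e : ℕ → ℚ) (c N : ℕ) (h : c ≤ N) :
    ∑ b ∈ Finset.Ico c N, ((N : ℚ) - b) * (e (b + 2) - 2 * e (b + 1) + e b) =
      e (N + 1) - (N - c + 1) * e (c + 1) + (N - c) * e c := by
  have key : ∀ n, c ≤ n → ∑ b ∈ Finset.Ico c n,
      ((N : ℚ) - b) * (e (b + 2) - 2 * e (b + 1) + e b) =
      ((N - n + 1) * e (n + 1) - (N - n) * e n) -
        ((N - c + 1) * e (c + 1) - (N - c) * e c) := by
    intro n hn
    induction n, hn using Nat.le_induction with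
    | base => simp
    | succ n hn ih => rw [Finset.sum_Ico_succ_top hn, ih]; push_cast; ring
  rw [key N h]; ring

/-! ### Total degree bounds -/

theorem totalDegree_mul_le_of_le {a b : MvPolynomial (Fin 2) ℚ} {i j k : ℕ}
    (ha : a.totalDegree ≤ i) (hb : b.totalDegree ≤ j) (h : i + j ≤ k) :
    (a * b).totalDegree ≤ k :=
  (MvPolynomial.totalDegree_mul a b).trans (by omega)

theorem totalDegree_add_le_of_le {a b : MvPolynomial (Fin 2) ℚ} {k : ℕ}
    (ha : a.totalDegree ≤ k) (hb : b.totalDegree ≤ k) : (a + b).totalDegree ≤ k :=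
  (MvPolynomial.totalDegree_add a b).trans (max_le ha hb)

theorem totalDegree_sub_le_of_le {a b : MvPolynomial (Fin 2) ℚ} {k : ℕ}
    (ha : a.totalDegree ≤ k) (hb : b.totalDegree ≤ k) : (a - b).totalDegree ≤ k :=
  (MvPolynomial.totalDegree_sub a b).trans (max_le ha hb)

theorem totalDegree_pow_le_of_le {a : MvPolynomial (Fin 2) ℚ} {i : ℕ} (ha : a.totalDegree ≤ 1) :
    (a ^ i).totalDegree ≤ i :=
  (MvPolynomial.totalDegree_pow a i).trans (by nlinarith)

theorem totalDegree_C_mul_le_of_le {a : MvPolynomial (Fin 2) ℚ} {k : ℕ} (r : ℚ)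
    (ha : a.totalDegree ≤ k) : (MvPolynomial.C r * a).totalDegree ≤ k :=
  totalDegree_mul_le_of_le (MvPolynomial.totalDegree_C r).le ha (by omega)

theorem totalDegree_C_mul_X_pow_mul_le {a : MvPolynomial (Fin 2) ℚ} {j k : ℕ} (r : ℚ) (i : ℕ)
    (s : Fin 2) (ha : a.totalDegree ≤ j) (h : i + j ≤ k) :
    (MvPolynomial.C r * MvPolynomial.X s ^ i * a).totalDegree ≤ k := by
  rw [mul_assoc]
  exact totalDegree_C_mul_le_of_le r
    (totalDegree_mul_le_of_le (totalDegree_pow_le_of_le (MvPolynomial.totalDegree_X s).le) ha h)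

theorem totalDegree_polynomial_aeval_le {x : MvPolynomial (Fin 2) ℚ} (hx : x.totalDegree ≤ 1)
    {q : Polynomial ℚ} {k : ℕ} (hq : q.natDegree ≤ k) :
    (Polynomial.aeval x q).totalDegree ≤ k := by
  rw [Polynomial.aeval_eq_sum_range]
  refine MvPolynomial.totalDegree_finsetSum_le fun i hi => ?_
  rw [MvPolynomial.smul_eq_C_mul]
  have := Finset.mem_range.1 hi
  exact totalDegree_C_mul_le_of_le _ ((totalDegree_pow_le_of_le hx).trans (by omega))

theorem totalDegree_aeval_le {f : Fin 2 → MvPolynomial (Fin 2) ℚ}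
    (hf : ∀ i, (f i).totalDegree ≤ 1) (P : MvPolynomial (Fin 2) ℚ) :
    (MvPolynomial.aeval f P).totalDegree ≤ P.totalDegree := by
  rw [MvPolynomial.aeval_def, MvPolynomial.eval₂_eq']
  refine MvPolynomial.totalDegree_finsetSum_le fun s hs => ?_
  have hs' : s 0 + s 1 ≤ P.totalDegree := by
    have := MvPolynomial.le_totalDegree hs
    rwa [Finsupp.sum_fintype _ _ (fun _ => rfl), Fin.sum_univ_two] at this
  rw [Fin.prod_univ_two]
  exact totalDegree_C_mul_le_of_le _ (totalDegree_mul_le_of_le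
    (totalDegree_pow_le_of_le (hf 0)) (totalDegree_pow_le_of_le (hf 1)) hs')

/-! ### Second antidifferences of powers -/

theorem add_one_pow_add_sub_one_pow (n : ℕ) (x : ℚ) :
    (x + 1) ^ (n + 2) + (x - 1) ^ (n + 2) = 2 * x ^ (n + 2) + (n + 1) * (n + 2) * x ^ n +
      ∑ k ∈ Finset.range (n - 1), ((n + 2).choose k * (1 + (-1) ^ (n + 2 - k))) * x ^ k := by
  have h : (x + 1) ^ (n + 2) + (x - 1) ^ (n + 2) = ∑ k ∈ Finset.range (n + 3),
      ((n + 2).choose k * (1 + (-1) ^ (n + 2 - k))) * x ^ k := by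
    rw [sub_eq_add_neg, add_pow, add_pow, ← Finset.sum_add_distrib]
    refine Finset.sum_congr rfl fun k _ => ?_
    rw [one_pow]; ring
  have hchoose : ((n + 2).choose n : ℚ) = (n + 1) * (n + 2) / 2 := by
    rw [Nat.choose_symm_add, Nat.cast_choose_two]
    push_cast; ring
  rw [h, Finset.sum_range_succ, Finset.sum_range_succ, Finset.sum_range_succ, hchoose,
    show n + 2 - n = 2 by omega, show n + 2 - (n + 1) = 1 by omega, Nat.sub_self,
    Nat.choose_self]
  rcases n with _ | n
  · simp; ring
  · rw [Finset.sum_range_succ, show n + 1 + 2 - n = 3 by omega, Nat.add_sub_cancel]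
    push_cast; ring

/-- Every power has a second antidifference whose degree drops by two after removing the leading
term. The continuous analogue is `(x ^ (n + 2) / ((n + 1) * (n + 2)))'' = x ^ n`. -/
theorem exists_second_antidifference (n : ℕ) :
    ∃ E : Polynomial ℚ,
      (∀ x : ℚ, E.eval (x + 1) - 2 * E.eval x + E.eval (x - 1) = x ^ n) ∧
      (E - Polynomial.C (1 / (((n : ℚ) + 1) * (n + 2))) * Polynomial.X ^ (n + 2)).natDegree ≤ n := by
  induction n using Nat.strong_induction_on with
  | _ n ih =>
    have ih' : ∀ k, ∃ E : Polynomial ℚ, k < n →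
        (∀ x : ℚ, E.eval (x + 1) - 2 * E.eval x + E.eval (x - 1) = x ^ k) ∧
        E.natDegree ≤ k + 2 := by
      intro k
      by_cases hk : k < n
      · obtain ⟨E, h1, h2⟩ := ih k hk
        refine ⟨E, fun _ => ⟨h1, ?_⟩⟩
        rw [← sub_add_cancel E (Polynomial.C (1 / (((k : ℚ) + 1) * (k + 2))) *
          Polynomial.X ^ (k + 2))]
        exact Polynomial.natDegree_add_le_of_degree_le (h2.trans (by omega))
          (Polynomial.natDegree_C_mul_X_pow_le _ _)
      · exact ⟨0, fun h => absurd h hk⟩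
    choose G hG using ih'
    have hpos : ((n : ℚ) + 1) * (n + 2) ≠ 0 := by positivity
    set κ : ℚ := 1 / (((n : ℚ) + 1) * (n + 2)) with hκ
    refine ⟨Polynomial.C κ * Polynomial.X ^ (n + 2) - Polynomial.C κ *
      ∑ k ∈ Finset.range (n - 1),
        Polynomial.C (((n + 2).choose k * (1 + (-1) ^ (n + 2 - k)) : ℚ)) * G k, fun x => ?_, ?_⟩
    · have hs : ∑ k ∈ Finset.range (n - 1), ((n + 2).choose k * (1 + (-1) ^ (n + 2 - k)) : ℚ) *
            x ^ k =
          ∑ k ∈ Finset.range (n - 1), ((n + 2).choose k * (1 + (-1) ^ (n + 2 - k)) : ℚ) *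
            (G k).eval (x + 1) -
          2 * ∑ k ∈ Finset.range (n - 1), ((n + 2).choose k * (1 + (-1) ^ (n + 2 - k)) : ℚ) *
            (G k).eval x +
          ∑ k ∈ Finset.range (n - 1), ((n + 2).choose k * (1 + (-1) ^ (n + 2 - k)) : ℚ) *
            (G k).eval (x - 1) := by
        rw [Finset.mul_sum, ← Finset.sum_sub_distrib, ← Finset.sum_add_distrib]
        refine Finset.sum_congr rfl fun k hk => ?_
        have := Finset.mem_range.1 hk
        rw [← (hG k (by omega)).1 x]; ring
      have hp := add_one_pow_add_sub_one_pow n x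
      rw [hs] at hp
      simp only [Polynomial.eval_sub, Polynomial.eval_mul, Polynomial.eval_C,
        Polynomial.eval_pow, Polynomial.eval_X, Polynomial.eval_finsetSum]
      have h1 : κ * (((n : ℚ) + 1) * (n + 2) * x ^ n) = x ^ n := by
        rw [hκ]; field_simp
      linear_combination κ * hp + h1
    · rw [sub_sub_cancel_left, Polynomial.natDegree_neg]
      refine (Polynomial.natDegree_C_mul_le _ _).trans ?_
      refine Polynomial.natDegree_sum_le_of_forall_le _ _ fun k hk => ?_
      have := Finset.mem_range.1 hk
      exact (Polynomial.natDegree_C_mul_le _ _).trans ((hG k (by omega)).2.trans (by omega))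

/-! ### The recursions act on polynomials -/

/-- The value of a polynomial in `p` and `u` at `p = 2N + 1` and `u = c + 1/2`. -/
noncomputable def evalHalf (P : MvPolynomial (Fin 2) ℚ) (N c : ℕ) : ℚ :=
  MvPolynomial.eval ![2 * (N : ℚ) + 1, (c : ℚ) + 1 / 2] P

/-- `F` is the result of applying the family of functionals `T` to `P`, where `P` and `F` are
read as functions of `p = 2N + 1` and `u = c + 1/2`. -/
def Transforms (T : ℕ → ℕ → (ℕ → ℚ) →ₗ[ℚ] ℚ) (P F : MvPolynomial (Fin 2) ℚ) : Prop :=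
  ∀ N c, c < N → evalHalf F N c = T N c (evalHalf P N)

theorem Transforms.add {T : ℕ → ℕ → (ℕ → ℚ) →ₗ[ℚ] ℚ} {P F Q G : MvPolynomial (Fin 2) ℚ}
    (h : Transforms T P F) (h' : Transforms T Q G) : Transforms T (P + Q) (F + G) := by
  intro N c hc
  have : evalHalf (P + Q) N = evalHalf P N + evalHalf Q N := by
    funext b; simp [evalHalf]
  rw [this, map_add, ← h N c hc, ← h' N c hc]
  simp [evalHalf]

theorem Transforms.sum {ι : Type*} {T : ℕ → ℕ → (ℕ → ℚ) →ₗ[ℚ] ℚ} (s : Finset ι)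
    {P F : ι → MvPolynomial (Fin 2) ℚ} (h : ∀ i ∈ s, Transforms T (P i) (F i)) :
    Transforms T (∑ i ∈ s, P i) (∑ i ∈ s, F i) := by
  classical
  induction s using Finset.induction_on with
  | empty =>
    intro N c _
    have : evalHalf (0 : MvPolynomial (Fin 2) ℚ) N = 0 := by funext b; simp [evalHalf]
    rw [Finset.sum_empty, Finset.sum_empty, this, map_zero]
    rfl
  | insert a s ha ih =>
    rw [Finset.sum_insert ha, Finset.sum_insert ha]
    exact (h a (Finset.mem_insert_self a s)).add
      (ih fun i hi => h i (Finset.mem_insert_of_mem hi))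

theorem Transforms.C_mul_X_pow_mul {T : ℕ → ℕ → (ℕ → ℚ) →ₗ[ℚ] ℚ}
    {P F : MvPolynomial (Fin 2) ℚ} (h : Transforms T P F) (r : ℚ) (i : ℕ) :
    Transforms T (MvPolynomial.C r * MvPolynomial.X 0 ^ i * P)
      (MvPolynomial.C r * MvPolynomial.X 0 ^ i * F) := by
  intro N c hc
  have : evalHalf (MvPolynomial.C r * MvPolynomial.X 0 ^ i * P) N =
      (r * (2 * (N : ℚ) + 1) ^ i) • evalHalf P N := by
    funext b; simp [evalHalf]
  rw [this, map_smul, ← h N c hc]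
  simp [evalHalf]

/-- It suffices to transform powers of `u`, since `p` is a scalar for the functionals `T N c`. -/
theorem exists_transforms_of_X_pow {T : ℕ → ℕ → (ℕ → ℚ) →ₗ[ℚ] ℚ} {k : ℕ}
    (hT : ∀ n, ∃ F, Transforms T (MvPolynomial.X 1 ^ n) F ∧ F.totalDegree ≤ n + k)
    (P : MvPolynomial (Fin 2) ℚ) :
    ∃ F, Transforms T P F ∧ F.totalDegree ≤ P.totalDegree + k := by
  choose F hF hdeg using hT
  refine ⟨∑ s ∈ P.support, MvPolynomial.C (P.coeff s) * MvPolynomial.X 0 ^ (s 0) * F (s 1),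
    ?_, ?_⟩
  · have hP : P = ∑ s ∈ P.support,
        MvPolynomial.C (P.coeff s) * MvPolynomial.X 0 ^ (s 0) * MvPolynomial.X 1 ^ (s 1) := by
      conv_lhs => rw [P.as_sum]
      refine Finset.sum_congr rfl fun s _ => ?_
      rw [MvPolynomial.monomial_eq, Finsupp.prod_fintype _ _ (fun _ => pow_zero _),
        Fin.prod_univ_two, mul_assoc]
    conv => arg 2; rw [hP]
    exact Transforms.sum _ fun s _ => (hF (s 1)).C_mul_X_pow_mul _ _
  · refine MvPolynomial.totalDegree_finsetSum_le fun s hs => ?_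
    have hs' : s 0 + s 1 ≤ P.totalDegree := by
      have := MvPolynomial.le_totalDegree hs
      rwa [Finsupp.sum_fintype _ _ (fun _ => rfl), Fin.sum_univ_two] at this
    exact totalDegree_C_mul_X_pow_mul_le _ _ _ (hdeg (s 1)) (by omega)

/-- The recursion of the total counts: summation against the kernel
`(2 min(b, c) + 1) (N - max(b, c))`. -/
noncomputable def totalOp (N c : ℕ) : (ℕ → ℚ) →ₗ[ℚ] ℚ :=
  ((N : ℚ) - c) • ∑ b ∈ Finset.range c, (2 * (b : ℚ) + 1) • LinearMap.proj b +
    (2 * (c : ℚ) + 1) • ∑ b ∈ Finset.Ico c N, ((N : ℚ) - b) • LinearMap.proj b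

/-- The recursion of the signed counts: summation against the kernel `N - max(b, c)`. -/
noncomputable def signedOp (N c : ℕ) : (ℕ → ℚ) →ₗ[ℚ] ℚ :=
  ((N : ℚ) - c) • ∑ b ∈ Finset.range c, LinearMap.proj b +
    ∑ b ∈ Finset.Ico c N, ((N : ℚ) - b) • LinearMap.proj b

theorem totalOp_apply (N c : ℕ) (f : ℕ → ℚ) :
    totalOp N c f = (N - c) * ∑ b ∈ Finset.range c, (2 * b + 1) * f b +
      (2 * c + 1) * ∑ b ∈ Finset.Ico c N, (N - b) * f b := by
  simp [totalOp]

theorem signedOp_apply (N c : ℕ) (f : ℕ → ℚ) :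
    signedOp N c f = (N - c) * ∑ b ∈ Finset.range c, f b +
      ∑ b ∈ Finset.Ico c N, (N - b) * f b := by
  simp [signedOp]

theorem evalHalf_X_pow_eq_second_difference {n : ℕ} {E : Polynomial ℚ}
    (hE : ∀ x : ℚ, E.eval (x + 1) - 2 * E.eval x + E.eval (x - 1) = x ^ n) (N b : ℕ) :
    evalHalf (MvPolynomial.X 1 ^ n) N b =
      E.eval (((b + 2 : ℕ) : ℚ) - 1 / 2) - 2 * E.eval (((b + 1 : ℕ) : ℚ) - 1 / 2) +
        E.eval ((b : ℚ) - 1 / 2) := by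
  have h := hE ((b : ℚ) + 1 / 2)
  have e1 : ((b + 2 : ℕ) : ℚ) - 1 / 2 = (b : ℚ) + 1 / 2 + 1 := by push_cast; ring
  have e2 : ((b + 1 : ℕ) : ℚ) - 1 / 2 = (b : ℚ) + 1 / 2 := by push_cast; ring
  have e3 : (b : ℚ) - 1 / 2 = (b : ℚ) + 1 / 2 - 1 := by ring
  rw [e1, e2, e3, h]
  simp [evalHalf]

theorem evalHalf_aeval_X_one (E : Polynomial ℚ) (N c : ℕ) :
    evalHalf (Polynomial.aeval (MvPolynomial.X 1) E) N c = E.eval (((c + 1 : ℕ) : ℚ) - 1 / 2) := by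
  have h : (((c + 1 : ℕ) : ℚ) - 1 / 2) = c + 1 / 2 := by push_cast; ring
  rw [evalHalf, ← MvPolynomial.coe_aeval_eq_eval, RingHom.coe_coe,
    ← Polynomial.aeval_algHom_apply, h]
  simp

theorem evalHalf_aeval_half_X_zero (E : Polynomial ℚ) (N c : ℕ) :
    evalHalf (Polynomial.aeval (MvPolynomial.C (1 / 2) * MvPolynomial.X 0) E) N c =
      E.eval (((N + 1 : ℕ) : ℚ) - 1 / 2) := by
  have h : (((N + 1 : ℕ) : ℚ) - 1 / 2) = 1 / 2 * (2 * N + 1) := by push_cast; ring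
  rw [evalHalf, ← MvPolynomial.coe_aeval_eq_eval, RingHom.coe_coe,
    ← Polynomial.aeval_algHom_apply, h]
  simp

/-- The part of highest degree of the image of `u ^ n` under the recursion of the total counts:
the solution of `F'' = - p u ^ n` with `F = 0` at `u = 0` and at `u = p / 2`. -/
noncomputable def topPart (n : ℕ) : MvPolynomial (Fin 2) ℚ :=
  MvPolynomial.C (1 / (((n : ℚ) + 1) * (n + 2))) *
    (-(MvPolynomial.X 0 * MvPolynomial.X 1 ^ (n + 2)) +
      MvPolynomial.C (2 * (1 / 2) ^ (n + 2)) * MvPolynomial.X 0 ^ (n + 2) * MvPolynomial.X 1)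

theorem totalDegree_half_X_zero :
    (MvPolynomial.C (1 / 2) * MvPolynomial.X 0 : MvPolynomial (Fin 2) ℚ).totalDegree ≤ 1 :=
  totalDegree_C_mul_le_of_le _ (MvPolynomial.totalDegree_X _).le

/-- Summation by parts turns a second antidifference `E` of `u ^ n` into the closed form
`-p E(u) + 2u E(p/2) + (E(1/2) + E(-1/2)) (p/2 - u)`. -/
theorem exists_transforms_totalOp_X_pow (n : ℕ) :
    ∃ F, Transforms totalOp (MvPolynomial.X 1 ^ n) F ∧ (F - topPart n).totalDegree ≤ n + 1 := by
  obtain ⟨E, hE, hdeg⟩ := exists_second_antidifference n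
  set κ : ℚ := 1 / (((n : ℚ) + 1) * (n + 2)) with hκ
  set R := E - Polynomial.C κ * Polynomial.X ^ (n + 2) with hR
  set ν : ℚ := E.eval (1 / 2) + E.eval (-1 / 2) with hν
  refine ⟨-(MvPolynomial.X 0 * Polynomial.aeval (MvPolynomial.X 1) E) +
    MvPolynomial.C ν * (MvPolynomial.C (1 / 2) * MvPolynomial.X 0 - MvPolynomial.X 1) +
    MvPolynomial.C 2 * (MvPolynomial.X 1 *
      Polynomial.aeval (MvPolynomial.C (1 / 2) * MvPolynomial.X 0) E), ?_, ?_⟩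
  · intro N c hc
    have h1 := sum_range_two_mul_add_one_mul_second_difference
      (fun k => E.eval ((k : ℚ) - 1 / 2)) c
    have h2 := sum_Ico_sub_mul_second_difference (fun k => E.eval ((k : ℚ) - 1 / 2)) c N hc.le
    have hν' : E.eval (((1 : ℕ) : ℚ) - 1 / 2) + E.eval (((0 : ℕ) : ℚ) - 1 / 2) = ν := by
      rw [hν]; norm_num
    simp only [hν'] at h1
    rw [totalOp_apply]
    simp only [evalHalf_X_pow_eq_second_difference hE]
    rw [h1, h2]
    have e1 := evalHalf_aeval_X_one E N c
    have e2 := evalHalf_aeval_half_X_zero E N c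
    rw [← e1, ← e2]
    simp only [evalHalf, map_add, map_neg, map_mul, map_sub, MvPolynomial.eval_X,
      MvPolynomial.eval_C, Matrix.cons_val_zero, Matrix.cons_val_one]
    ring
  · have hE' : E = R + Polynomial.C κ * Polynomial.X ^ (n + 2) := by rw [hR]; ring
    have key : -(MvPolynomial.X 0 * Polynomial.aeval (MvPolynomial.X 1) E) +
        MvPolynomial.C ν * (MvPolynomial.C (1 / 2) * MvPolynomial.X 0 - MvPolynomial.X 1) +
        MvPolynomial.C 2 * (MvPolynomial.X 1 *
          Polynomial.aeval (MvPolynomial.C (1 / 2) * MvPolynomial.X 0) E) - topPart n =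
        MvPolynomial.C ν * (MvPolynomial.C (1 / 2) * MvPolynomial.X 0 - MvPolynomial.X 1) +
        MvPolynomial.C 2 * (MvPolynomial.X 1 *
          Polynomial.aeval (MvPolynomial.C (1 / 2) * MvPolynomial.X 0) R) -
        MvPolynomial.X 0 * Polynomial.aeval (MvPolynomial.X 1 : MvPolynomial (Fin 2) ℚ) R := by
      conv_lhs => rw [hE']
      simp only [topPart, ← hκ, map_add, map_mul, map_pow, Polynomial.aeval_X,
        Polynomial.aeval_C, MvPolynomial.algebraMap_eq, mul_pow]
      ring
    rw [key]
    have hX : ∀ s : Fin 2, (MvPolynomial.X s : MvPolynomial (Fin 2) ℚ).totalDegree ≤ 1 :=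
      fun s => (MvPolynomial.totalDegree_X s).le
    refine totalDegree_sub_le_of_le (totalDegree_add_le_of_le ?_ ?_) ?_
    · exact totalDegree_C_mul_le_of_le _
        ((totalDegree_sub_le_of_le totalDegree_half_X_zero (hX 1)).trans (by omega))
    · exact totalDegree_C_mul_le_of_le _ (totalDegree_mul_le_of_le (hX 1)
        (totalDegree_polynomial_aeval_le totalDegree_half_X_zero hdeg) (by omega))
    · exact totalDegree_mul_le_of_le (hX 0)
        (totalDegree_polynomial_aeval_le (hX 1) hdeg) (by omega)

theorem totalDegree_topPart_le (n : ℕ) : (topPart n).totalDegree ≤ n + 3 := by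
  have hX : ∀ s : Fin 2, (MvPolynomial.X s : MvPolynomial (Fin 2) ℚ).totalDegree ≤ 1 :=
    fun s => (MvPolynomial.totalDegree_X s).le
  refine totalDegree_C_mul_le_of_le _ (totalDegree_add_le_of_le ?_ ?_)
  · rw [MvPolynomial.totalDegree_neg]
    exact totalDegree_mul_le_of_le (hX 0) (totalDegree_pow_le_of_le (hX 1)) (by omega)
  · exact totalDegree_C_mul_X_pow_mul_le _ _ _ (hX 1) (by omega)

theorem exists_transforms_totalOp (P : MvPolynomial (Fin 2) ℚ) :
    ∃ F, Transforms totalOp P F ∧ F.totalDegree ≤ P.totalDegree + 3 := by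
  refine exists_transforms_of_X_pow (fun n => ?_) P
  obtain ⟨F, hF, hdeg⟩ := exists_transforms_totalOp_X_pow n
  refine ⟨F, hF, ?_⟩
  rw [← sub_add_cancel F (topPart n)]
  exact totalDegree_add_le_of_le (hdeg.trans (by omega)) (totalDegree_topPart_le n)

/-- For a second antidifference `E` of `u ^ n`, the image of `u ^ n` is
`E(p/2) - E(u) - (E(1/2) - E(-1/2)) (p/2 - u)`. -/
theorem exists_transforms_signedOp (P : MvPolynomial (Fin 2) ℚ) :
    ∃ F, Transforms signedOp P F ∧ F.totalDegree ≤ P.totalDegree + 2 := by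
  refine exists_transforms_of_X_pow (fun n => ?_) P
  obtain ⟨E, hE, hdeg⟩ := exists_second_antidifference n
  have hdegE : E.natDegree ≤ n + 2 := by
    rw [← sub_add_cancel E (Polynomial.C (1 / (((n : ℚ) + 1) * (n + 2))) *
      Polynomial.X ^ (n + 2))]
    exact Polynomial.natDegree_add_le_of_degree_le (hdeg.trans (by omega))
      (Polynomial.natDegree_C_mul_X_pow_le _ _)
  set ν : ℚ := E.eval (1 / 2) - E.eval (-1 / 2) with hν
  have hX : ∀ s : Fin 2, (MvPolynomial.X s : MvPolynomial (Fin 2) ℚ).totalDegree ≤ 1 :=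
    fun s => (MvPolynomial.totalDegree_X s).le
  refine ⟨Polynomial.aeval (MvPolynomial.C (1 / 2) * MvPolynomial.X 0) E -
    Polynomial.aeval (MvPolynomial.X 1) E -
    MvPolynomial.C ν * (MvPolynomial.C (1 / 2) * MvPolynomial.X 0 - MvPolynomial.X 1), ?_, ?_⟩
  · intro N c hc
    have h1 := sum_range_second_difference (fun k => E.eval ((k : ℚ) - 1 / 2)) c
    have h2 := sum_Ico_sub_mul_second_difference (fun k => E.eval ((k : ℚ) - 1 / 2)) c N hc.le
    have hν' : E.eval (((1 : ℕ) : ℚ) - 1 / 2) - E.eval (((0 : ℕ) : ℚ) - 1 / 2) = ν := by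
      rw [hν]; norm_num
    simp only [hν'] at h1
    rw [signedOp_apply]
    simp only [evalHalf_X_pow_eq_second_difference hE]
    rw [h1, h2]
    have e1 := evalHalf_aeval_X_one E N c
    have e2 := evalHalf_aeval_half_X_zero E N c
    rw [← e1, ← e2]
    simp only [evalHalf, map_mul, map_sub, MvPolynomial.eval_X,
      MvPolynomial.eval_C, Matrix.cons_val_zero, Matrix.cons_val_one]
    ring
  · refine totalDegree_sub_le_of_le (totalDegree_sub_le_of_le ?_ ?_) ?_
    · exact totalDegree_polynomial_aeval_le totalDegree_half_X_zero hdegE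
    · exact totalDegree_polynomial_aeval_le (hX 1) hdegE
    · exact totalDegree_C_mul_le_of_le _
        ((totalDegree_sub_le_of_le totalDegree_half_X_zero (hX 1)).trans (by omega))

/-! ### The leading part and Bernoulli numbers -/

/-- The homogeneous polynomial
`p ^ (3 * m + 1) * (-1) ^ (m + 1) / (2 * m + 1)! * B_{2m+1}(u / p)`, where `B_{2m+1}` is the
Bernoulli polynomial, `p = X 0` and `u = X 1`. It is the part of highest degree of the total count
of genus `m + 1`, expressed in `u = c + 1/2`. -/
noncomputable def bernoulliPart (m : ℕ) : MvPolynomial (Fin 2) ℚ :=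
  MvPolynomial.C ((-1) ^ (m + 1)) * ∑ k ∈ Finset.range (2 * m + 2),
    MvPolynomial.C (bernoulli k / k.factorial / (2 * m + 1 - k).factorial) *
      MvPolynomial.X 0 ^ (m + k) * MvPolynomial.X 1 ^ (2 * m + 1 - k)

/-- The relation `B_{2m+3}(1/2) = 0`, solved for `B_{2m+2}`. -/
theorem sum_bernoulli_half (m : ℕ) :
    ∑ k ∈ Finset.range (2 * m + 2), bernoulli k / k.factorial *
      ((1 / 2) ^ (2 * m + 3 - k) / (2 * m + 3 - k).factorial) =
    -(bernoulli (2 * m + 2) / (2 * m + 2).factorial) / 2 := by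
  have h0 : (Polynomial.bernoulli (2 * m + 3)).eval (1 / 2) = 0 := by
    have h := Polynomial.bernoulli_eval_one_sub (2 * m + 3) (1 / 2)
    rw [show (1 : ℚ) - 1 / 2 = 1 / 2 by norm_num,
      (show Odd (2 * m + 3) from ⟨m + 1, by ring⟩).neg_one_pow] at h
    linarith
  have hB : bernoulli (2 * m + 3) = 0 := bernoulli_eq_zero_of_odd ⟨m + 1, by ring⟩ (by omega)
  have h1 : ∑ k ∈ Finset.range (2 * m + 4), bernoulli k / k.factorial *
      ((1 / 2) ^ (2 * m + 3 - k) / (2 * m + 3 - k).factorial) = 0 := by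
    have hf : ((2 * m + 3).factorial : ℚ) ≠ 0 := by positivity
    rw [Polynomial.bernoulli, Polynomial.eval_finsetSum] at h0
    rw [← mul_right_inj' hf, mul_zero, ← h0, Finset.mul_sum]
    refine Finset.sum_congr rfl fun k hk => ?_
    have hk' : k ≤ 2 * m + 3 := by have := Finset.mem_range.1 hk; omega
    rw [Polynomial.eval_monomial, Nat.cast_choose ℚ hk']
    field_simp
  rw [Finset.sum_range_succ, Finset.sum_range_succ, hB,
    show 2 * m + 3 - (2 * m + 2) = 1 by omega] at h1
  simp only [pow_one, Nat.factorial_one, Nat.cast_one, zero_div, zero_mul, add_zero] at h1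
  linarith

theorem bernoulliPart_succ (m : ℕ) :
    bernoulliPart (m + 1) = ∑ k ∈ Finset.range (2 * m + 2),
      MvPolynomial.C ((-1) ^ (m + 1) * (bernoulli k / k.factorial / (2 * m + 1 - k).factorial)) *
        MvPolynomial.X 0 ^ (m + k) * topPart (2 * m + 1 - k) := by
  have hB : bernoulli (2 * m + 3) = 0 := bernoulli_eq_zero_of_odd ⟨m + 1, by ring⟩ (by omega)
  have hterm : ∀ k ∈ Finset.range (2 * m + 2),
      (MvPolynomial.C ((-1) ^ (m + 1) *
          (bernoulli k / k.factorial / (2 * m + 1 - k).factorial)) *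
        MvPolynomial.X 0 ^ (m + k) * topPart (2 * m + 1 - k) : MvPolynomial (Fin 2) ℚ) =
      MvPolynomial.C ((-1) ^ (m + 2)) *
        (MvPolynomial.C (bernoulli k / k.factorial / (2 * (m + 1) + 1 - k).factorial) *
          MvPolynomial.X 0 ^ (m + 1 + k) * MvPolynomial.X 1 ^ (2 * (m + 1) + 1 - k)) +
      MvPolynomial.C ((-1) ^ (m + 1) * 2 * (bernoulli k / k.factorial *
        ((1 / 2) ^ (2 * m + 3 - k) / (2 * m + 3 - k).factorial))) *
        (MvPolynomial.X 0 ^ (3 * m + 3) * MvPolynomial.X 1) := by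
    intro k hk
    obtain ⟨n, hn⟩ : ∃ n, 2 * m + 1 - k = n := ⟨_, rfl⟩
    have hk' := Finset.mem_range.1 hk
    rw [hn, show 2 * (m + 1) + 1 - k = n + 2 by omega, show 2 * m + 3 - k = n + 2 by omega,
      show 3 * m + 3 = m + k + (n + 2) by omega]
    have hfac : bernoulli k / k.factorial / (n + 2).factorial =
        bernoulli k / k.factorial / n.factorial * (1 / (((n : ℚ) + 1) * (n + 2))) := by
      rw [Nat.factorial_succ, Nat.factorial_succ]
      push_cast
      have : (n : ℚ) + 1 + 1 = n + 2 := by ring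
      rw [this]
      field_simp
    have hfac' : (-1) ^ (m + 1) * 2 * (bernoulli k / k.factorial *
        ((1 / 2) ^ (n + 2) / (n + 2).factorial)) = (-1) ^ (m + 1) *
        (bernoulli k / k.factorial / n.factorial) * (1 / (((n : ℚ) + 1) * (n + 2))) *
        (2 * (1 / 2) ^ (n + 2)) := by
      linear_combination (-1) ^ (m + 1) * 2 * (1 / 2) ^ (n + 2) * hfac
    rw [hfac', hfac, topPart, pow_succ _ (m + 1)]
    simp only [map_mul, map_neg, map_one]
    ring
  rw [Finset.sum_congr rfl hterm, Finset.sum_add_distrib, ← Finset.mul_sum, ← Finset.sum_mul,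
    ← map_sum, ← Finset.mul_sum, sum_bernoulli_half, bernoulliPart,
    show 2 * (m + 1) + 2 = 2 * m + 2 + 1 + 1 by ring, Finset.sum_range_succ,
    Finset.sum_range_succ, hB, show 2 * (m + 1) + 1 - (2 * m + 2) = 1 by omega,
    show m + 1 + (2 * m + 2) = 3 * m + 3 by ring, pow_succ _ (m + 1)]
  simp only [map_mul, map_neg, map_one, zero_div, map_zero, zero_mul, add_zero, pow_one,
    Nat.factorial_one, Nat.cast_one, div_one]
  have h2 : (MvPolynomial.C (-(bernoulli (2 * m + 2) / (2 * m + 2).factorial) / 2) :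
      MvPolynomial (Fin 2) ℚ) * MvPolynomial.C 2 =
      -MvPolynomial.C (bernoulli (2 * m + 2) / (2 * m + 2).factorial) := by
    rw [← map_mul, ← map_neg]; congr 1; ring
  linear_combination (-MvPolynomial.C ((-1) ^ (m + 1)) * MvPolynomial.X 0 ^ (3 * m + 3) *
    MvPolynomial.X 1) * h2

theorem exists_transforms_bernoulliPart (m : ℕ) :
    ∃ F, Transforms totalOp (bernoulliPart m) F ∧
      (F - bernoulliPart (m + 1)).totalDegree ≤ 3 * m + 2 := by
  choose G hG hdeg using exists_transforms_totalOp_X_pow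
  refine ⟨∑ k ∈ Finset.range (2 * m + 2), MvPolynomial.C ((-1) ^ (m + 1) *
    (bernoulli k / k.factorial / (2 * m + 1 - k).factorial)) *
      MvPolynomial.X 0 ^ (m + k) * G (2 * m + 1 - k), ?_, ?_⟩
  · have : bernoulliPart m = ∑ k ∈ Finset.range (2 * m + 2), MvPolynomial.C ((-1) ^ (m + 1) *
        (bernoulli k / k.factorial / (2 * m + 1 - k).factorial)) *
          MvPolynomial.X 0 ^ (m + k) * MvPolynomial.X 1 ^ (2 * m + 1 - k) := by
      rw [bernoulliPart, Finset.mul_sum]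
      refine Finset.sum_congr rfl fun k _ => ?_
      rw [map_mul]; ring
    rw [this]
    exact Transforms.sum _ fun k _ => (hG _).C_mul_X_pow_mul _ _
  · rw [bernoulliPart_succ, ← Finset.sum_sub_distrib]
    refine MvPolynomial.totalDegree_finsetSum_le fun k hk => ?_
    have := Finset.mem_range.1 hk
    rw [← mul_sub]
    exact totalDegree_C_mul_X_pow_mul_le _ _ _ (hdeg _) (by omega)

/-- If `P` computes `f` on the range `c < N` and `f'` arises from `f` by the recursion `T`, then the
transform of `P` computes `f'`; the hypothesis `hT` says that `T` only reads values at `b < N`. -/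
theorem transforms_congr {T : ℕ → ℕ → (ℕ → ℚ) →ₗ[ℚ] ℚ} {P F : MvPolynomial (Fin 2) ℚ}
    (h : Transforms T P F) {f f' : ℕ → ℕ → ℚ} (hf : ∀ N c, c < N → evalHalf P N c = f N c)
    (hT : ∀ N c (a a' : ℕ → ℚ), c < N → (∀ b < N, a b = a' b) → T N c a = T N c a')
    (hf' : ∀ N c, c < N → f' N c = T N c (f N)) :
    ∀ N c, c < N → evalHalf F N c = f' N c := by
  intro N c hc
  rw [h N c hc, hf' N c hc]
  exact hT N c _ _ hc fun b hb => hf N b hb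

theorem totalOp_congr (N c : ℕ) (a a' : ℕ → ℚ) (hc : c < N) (h : ∀ b < N, a b = a' b) :
    totalOp N c a = totalOp N c a' := by
  rw [totalOp_apply, totalOp_apply]
  congr 2
  · exact Finset.sum_congr rfl fun b hb => by rw [h b ((Finset.mem_range.1 hb).trans hc)]
  · exact Finset.sum_congr rfl fun b hb => by rw [h b (Finset.mem_Ico.1 hb).2]

theorem signedOp_congr (N c : ℕ) (a a' : ℕ → ℚ) (hc : c < N) (h : ∀ b < N, a b = a' b) :
    signedOp N c a = signedOp N c a' := by
  rw [signedOp_apply, signedOp_apply]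
  congr 1
  · congr 1
    exact Finset.sum_congr rfl fun b hb => by rw [h b ((Finset.mem_range.1 hb).trans hc)]
  · exact Finset.sum_congr rfl fun b hb => by rw [h b (Finset.mem_Ico.1 hb).2]

/-- For `m = 0` there is no error term at all; the bound `3 * m - 1` on its degree only makes sense
from `m = 1` on, and the disjunction covers both cases. -/
theorem exists_polynomial_totalSum (m : ℕ) :
    ∃ P : MvPolynomial (Fin 2) ℚ,
      (∀ N c, c < N → evalHalf P N c = totalSum (m + 1) N c) ∧
      (P = bernoulliPart m ∨ (P - bernoulliPart m).totalDegree + 1 ≤ 3 * m) := by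
  induction m with
  | zero =>
    refine ⟨bernoulliPart 0, fun N c hc => ?_, Or.inl rfl⟩
    rw [totalSum_one N c hc]
    simp [evalHalf, bernoulliPart, Finset.sum_range_succ]
    ring
  | succ m ih =>
    obtain ⟨P, hP, hdeg⟩ := ih
    obtain ⟨F, hF, hFdeg⟩ := exists_transforms_bernoulliPart m
    have hrec : ∀ N c, c < N → totalSum (m + 2) N c = totalOp N c (totalSum (m + 1) N) :=
      fun N c hc => by rw [totalSum_add_two m N c hc, totalOp_apply]
    rcases hdeg with rfl | hdeg
    · exact ⟨F, transforms_congr hF hP totalOp_congr hrec, Or.inr (by omega)⟩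
    · obtain ⟨G, hG, hGdeg⟩ := exists_transforms_totalOp (P - bernoulliPart m)
      have hsum := hF.add hG
      rw [add_sub_cancel] at hsum
      refine ⟨F + G, transforms_congr hsum hP totalOp_congr hrec, Or.inr ?_⟩
      rw [add_sub_right_comm]
      have := totalDegree_add_le_of_le hFdeg (hGdeg.trans (by omega : _ ≤ 3 * m + 2))
      omega

theorem exists_polynomial_signedSum (m : ℕ) :
    ∃ Q : MvPolynomial (Fin 2) ℚ,
      (∀ N c, c < N → evalHalf Q N c = signedSum (m + 1) N c) ∧ Q.totalDegree ≤ 2 * m + 1 := by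
  induction m with
  | zero =>
    refine ⟨MvPolynomial.C (1 / 2) * MvPolynomial.X 0 - MvPolynomial.X 1, fun N c hc => ?_,
      totalDegree_sub_le_of_le totalDegree_half_X_zero (MvPolynomial.totalDegree_X _).le⟩
    rw [signedSum_one N c hc]
    simp [evalHalf]
    ring
  | succ m ih =>
    obtain ⟨Q, hQ, hdeg⟩ := ih
    obtain ⟨F, hF, hFdeg⟩ := exists_transforms_signedOp Q
    exact ⟨F, transforms_congr hF hQ signedOp_congr
      fun N c hc => by rw [signedSum_add_two m N c hc, signedOp_apply], by omega⟩

/-! ### Back to the variables `p` and `c` -/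

/-- The substitution `u = c + 1/2`. -/
noncomputable def shiftHalf :
    MvPolynomial (Fin 2) ℚ →ₐ[ℚ] MvPolynomial (Fin 2) ℚ :=
  MvPolynomial.aeval ![MvPolynomial.X 0, MvPolynomial.X 1 + MvPolynomial.C (1 / 2)]

theorem totalDegree_X_add_half :
    (MvPolynomial.X 1 + MvPolynomial.C (1 / 2) : MvPolynomial (Fin 2) ℚ).totalDegree ≤ 1 :=
  totalDegree_add_le_of_le (MvPolynomial.totalDegree_X _).le
    ((MvPolynomial.totalDegree_C _).le.trans zero_le_one)

theorem totalDegree_shiftHalf_le (P : MvPolynomial (Fin 2) ℚ) :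
    (shiftHalf P).totalDegree ≤ P.totalDegree := by
  refine totalDegree_aeval_le (fun i => ?_) P
  fin_cases i
  · exact (MvPolynomial.totalDegree_X _).le
  · exact totalDegree_X_add_half

theorem eval_shiftHalf (P : MvPolynomial (Fin 2) ℚ) (N c : ℕ) :
    MvPolynomial.eval ![((2 * N + 1 : ℕ) : ℚ), (c : ℚ)] (shiftHalf P) = evalHalf P N c := by
  have h : (MvPolynomial.aeval ![((2 * N + 1 : ℕ) : ℚ), (c : ℚ)]).comp shiftHalf =
      MvPolynomial.aeval ![2 * (N : ℚ) + 1, (c : ℚ) + 1 / 2] := by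
    refine MvPolynomial.algHom_ext fun i => ?_
    fin_cases i <;> simp [shiftHalf]
  rw [evalHalf, ← MvPolynomial.coe_aeval_eq_eval, ← MvPolynomial.coe_aeval_eq_eval,
    RingHom.coe_coe, RingHom.coe_coe, ← h, AlgHom.comp_apply]

/-- The first two terms of `(c + 1/2) ^ (j + 2)` split off. The factor `1 + 2c / (2g - 1 - k)` of
the leading part consists of these two terms. -/
theorem totalDegree_shift_pow_sub_le (j : ℕ) :
    ((MvPolynomial.X 1 + MvPolynomial.C (1 / 2)) ^ (j + 2) - MvPolynomial.X 1 ^ (j + 2) -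
      MvPolynomial.C (((j : ℚ) + 2) / 2) * MvPolynomial.X 1 ^ (j + 1) :
      MvPolynomial (Fin 2) ℚ).totalDegree ≤ j := by
  induction j with
  | zero =>
    have : ((MvPolynomial.X 1 + MvPolynomial.C (1 / 2)) ^ (0 + 2) - MvPolynomial.X 1 ^ (0 + 2) -
        MvPolynomial.C ((((0 : ℕ) : ℚ) + 2) / 2) * MvPolynomial.X 1 ^ (0 + 1) :
        MvPolynomial (Fin 2) ℚ) = MvPolynomial.C (1 / 4) := by
      have h1 : (MvPolynomial.C (1 / 2) : MvPolynomial (Fin 2) ℚ) * MvPolynomial.C (1 / 2) =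
        MvPolynomial.C (1 / 4) := by rw [← map_mul]; norm_num
      have h2 : (MvPolynomial.C (1 / 2) : MvPolynomial (Fin 2) ℚ) + MvPolynomial.C (1 / 2) =
        MvPolynomial.C ((((0 : ℕ) : ℚ) + 2) / 2) := by rw [← map_add]; norm_num
      linear_combination h1 + MvPolynomial.X 1 * h2
    rw [this, MvPolynomial.totalDegree_C]
  | succ j ih =>
    have h1 : (MvPolynomial.C (1 / 2) : MvPolynomial (Fin 2) ℚ) *
        MvPolynomial.C (((j : ℚ) + 2) / 2) = MvPolynomial.C (((j : ℚ) + 2) / 4) := by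
      rw [← map_mul]; congr 1; ring
    have h2 : (MvPolynomial.C (1 / 2) : MvPolynomial (Fin 2) ℚ) +
        MvPolynomial.C (((j : ℚ) + 2) / 2) = MvPolynomial.C ((((j + 1 : ℕ) : ℚ) + 2) / 2) := by
      rw [← map_add]; congr 1; push_cast; ring
    have key : ((MvPolynomial.X 1 + MvPolynomial.C (1 / 2)) ^ (j + 1 + 2) -
        MvPolynomial.X 1 ^ (j + 1 + 2) -
        MvPolynomial.C ((((j + 1 : ℕ) : ℚ) + 2) / 2) * MvPolynomial.X 1 ^ (j + 1 + 1) :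
        MvPolynomial (Fin 2) ℚ) =
        (MvPolynomial.X 1 + MvPolynomial.C (1 / 2)) *
          ((MvPolynomial.X 1 + MvPolynomial.C (1 / 2)) ^ (j + 2) - MvPolynomial.X 1 ^ (j + 2) -
            MvPolynomial.C (((j : ℚ) + 2) / 2) * MvPolynomial.X 1 ^ (j + 1)) +
        MvPolynomial.C (((j : ℚ) + 2) / 4) * MvPolynomial.X 1 ^ (j + 1) := by
      linear_combination MvPolynomial.X 1 ^ (j + 1) * h1 + MvPolynomial.X 1 ^ (j + 2) * h2
    rw [key]
    exact totalDegree_add_le_of_le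
      (totalDegree_mul_le_of_le totalDegree_X_add_half ih (by omega))
      (totalDegree_C_mul_le_of_le _
        (totalDegree_pow_le_of_le (MvPolynomial.totalDegree_X _).le))

theorem totalDegree_shiftHalf_bernoulliPart_sub_le (m : ℕ) (hm : 1 ≤ m) :
    (MvPolynomial.C (1 / 2) * shiftHalf (bernoulliPart m) - leadingPart (m + 1)).totalDegree ≤
      3 * m - 1 := by
  have hB : bernoulli (2 * m + 1) = 0 := bernoulli_eq_zero_of_odd ⟨m, rfl⟩ (by omega)
  have key : MvPolynomial.C (1 / 2) * shiftHalf (bernoulliPart m) - leadingPart (m + 1) =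
      ∑ k ∈ Finset.range (2 * m + 1), MvPolynomial.C ((-1) ^ (m + 1) / 2 *
        (bernoulli k / k.factorial / (2 * m + 1 - k).factorial)) * MvPolynomial.X 0 ^ (m + k) *
        ((MvPolynomial.X 1 + MvPolynomial.C (1 / 2)) ^ (2 * m - k + 1) -
          MvPolynomial.X 1 ^ (2 * m - k + 1) -
          MvPolynomial.C ((((2 * m - k : ℕ) : ℚ) + 1) / 2) *
            MvPolynomial.X 1 ^ (2 * m - k)) := by
    rw [bernoulliPart, leadingPart, Finset.sum_range_succ, hB, zero_div, zero_div, map_zero,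
      zero_mul, zero_mul, add_zero, show 2 * (m + 1) - 1 = 2 * m + 1 by omega,
      map_mul, map_sum, Finset.mul_sum, Finset.mul_sum, Finset.mul_sum, ← Finset.sum_sub_distrib]
    refine Finset.sum_congr rfl fun k hk => ?_
    obtain ⟨j, hj⟩ : ∃ j, 2 * m - k = j := ⟨_, rfl⟩
    have hk' := Finset.mem_range.1 hk
    have hcast : 2 * ((m + 1 : ℕ) : ℚ) - 1 - k = j + 1 := by
      have : 2 * m = j + k := by omega
      have : (2 * m : ℚ) = j + k := by exact_mod_cast this
      push_cast; linarith
    rw [hj, hcast, show 2 * m + 1 - k = j + 1 by omega, show 2 * (m + 1) - 2 - k = j by omega,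
      show m + 1 - 1 + k = m + k by omega]
    have hC : ∀ r : ℚ, shiftHalf (MvPolynomial.C r) = MvPolynomial.C r :=
      fun r => shiftHalf.commutes r
    have hX0 : shiftHalf (MvPolynomial.X 0) = MvPolynomial.X 0 := by simp [shiftHalf]
    have hX1 : shiftHalf (MvPolynomial.X 1) = MvPolynomial.X 1 + MvPolynomial.C (1 / 2) := by
      simp [shiftHalf]
    rw [map_mul shiftHalf, map_mul shiftHalf, map_pow shiftHalf, map_pow shiftHalf,
      hC, hC, hX0, hX1]
    -- The scalars of the three kinds of monomials are compared in `ℚ`.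
    have e1 : (MvPolynomial.C (1 / 2) : MvPolynomial (Fin 2) ℚ) *
        (MvPolynomial.C ((-1) ^ (m + 1)) *
          MvPolynomial.C (bernoulli k / k.factorial / (j + 1).factorial)) =
        MvPolynomial.C ((-1) ^ (m + 1) / 2 * (bernoulli k / k.factorial / (j + 1).factorial)) := by
      rw [← map_mul, ← map_mul]; congr 1; ring
    have hf : ((j + 1).factorial : ℚ) = (j + 1) * j.factorial := by
      rw [Nat.factorial_succ]; push_cast; ring
    have e2 : (MvPolynomial.C ((-1) ^ (m + 1) / 4) : MvPolynomial (Fin 2) ℚ) *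
        (MvPolynomial.C (bernoulli k / k.factorial) * MvPolynomial.C (1 / (j.factorial : ℚ))) =
        MvPolynomial.C ((-1) ^ (m + 1) / 2 * (bernoulli k / k.factorial / (j + 1).factorial)) *
        MvPolynomial.C (((j : ℚ) + 1) / 2) := by
      rw [← map_mul, ← map_mul, ← map_mul]; congr 1
      rw [hf]; field_simp; ring
    have e3 : (MvPolynomial.C (((j : ℚ) + 1) / 2) : MvPolynomial (Fin 2) ℚ) *
        MvPolynomial.C (2 / ((j : ℚ) + 1)) = 1 := by
      rw [← map_mul, ← map_one MvPolynomial.C]; congr 1; field_simp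
    linear_combination MvPolynomial.X 0 ^ (m + k) *
      (MvPolynomial.X 1 + MvPolynomial.C (1 / 2)) ^ (j + 1) * e1 -
      MvPolynomial.X 1 ^ j * (1 + MvPolynomial.C (2 / ((j : ℚ) + 1)) * MvPolynomial.X 1) *
        MvPolynomial.X 0 ^ (m + k) * e2 -
      MvPolynomial.C ((-1) ^ (m + 1) / 2 * (bernoulli k / k.factorial / (j + 1).factorial)) *
        MvPolynomial.X 1 ^ (j + 1) * MvPolynomial.X 0 ^ (m + k) * e3
  rw [key]
  refine MvPolynomial.totalDegree_finsetSum_le fun k hk => ?_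
  have hk' := Finset.mem_range.1 hk
  rcases hj : 2 * m - k with _ | j
  · -- For `k = 2m` the difference vanishes identically.
    have : ((MvPolynomial.X 1 + MvPolynomial.C (1 / 2)) ^ (0 + 1) -
          MvPolynomial.X 1 ^ (0 + 1) - MvPolynomial.C ((((0 : ℕ) : ℚ) + 1) / 2) *
            MvPolynomial.X 1 ^ 0 : MvPolynomial (Fin 2) ℚ) = 0 := by
      rw [Nat.cast_zero, zero_add, zero_add]; ring
    rw [this, mul_zero, MvPolynomial.totalDegree_zero]
    omega
  · have h := totalDegree_shift_pow_sub_le j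
    rw [show (j : ℚ) + 2 = ((j + 1 : ℕ) : ℚ) + 1 by push_cast; ring] at h
    exact totalDegree_C_mul_X_pow_mul_le _ _ _ h (by omega)

theorem totalDegree_leadingPart_le (m : ℕ) : (leadingPart (m + 1)).totalDegree ≤ 3 * m + 1 := by
  have hX : ∀ s : Fin 2, (MvPolynomial.X s : MvPolynomial (Fin 2) ℚ).totalDegree ≤ 1 :=
    fun s => (MvPolynomial.totalDegree_X s).le
  refine totalDegree_C_mul_le_of_le _ (MvPolynomial.totalDegree_finsetSum_le fun k hk => ?_)
  have hk' := Finset.mem_range.1 hk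
  refine totalDegree_mul_le_of_le (j := m + k) (i := 2 * m - k + 1) ?_ ?_ (by omega)
  · refine totalDegree_mul_le_of_le (i := 2 * m - k) (j := 1) ?_ ?_ le_rfl
    · refine totalDegree_C_mul_le_of_le _ (totalDegree_C_mul_le_of_le _ ?_)
      exact (totalDegree_pow_le_of_le (hX 1)).trans (by omega)
    · exact totalDegree_add_le_of_le (by simp) (totalDegree_C_mul_le_of_le _ (hX 1))
  · exact (totalDegree_pow_le_of_le (hX 0)).trans (by omega)

theorem coeff_C_mul_X_pow_mul_X_pow (r : ℚ) (a b a' b' : ℕ) :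
    MvPolynomial.coeff (Finsupp.single 0 a' + Finsupp.single 1 b')
      (MvPolynomial.C r * MvPolynomial.X 0 ^ a * MvPolynomial.X 1 ^ b :
        MvPolynomial (Fin 2) ℚ) = if a = a' ∧ b = b' then r else 0 := by
  rw [MvPolynomial.C_mul_X_pow_eq_monomial, ← MvPolynomial.monomial_add_single,
    MvPolynomial.coeff_monomial]
  refine if_congr ⟨fun h => ⟨?_, ?_⟩, ?_⟩ rfl rfl
  · simpa using DFunLike.congr_fun h 0
  · simpa using DFunLike.congr_fun h 1
  · rintro ⟨rfl, rfl⟩; rfl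

/-- The monomial `p ^ m * c ^ (2m + 1)` comes only from the term with `k = 0`. -/
theorem coeff_leadingPart_ne_zero (m : ℕ) :
    MvPolynomial.coeff (Finsupp.single 0 m + Finsupp.single 1 (2 * m + 1))
      (leadingPart (m + 1)) ≠ 0 := by
  have hterm : ∀ k, MvPolynomial.coeff (Finsupp.single 0 m + Finsupp.single 1 (2 * m + 1))
      (MvPolynomial.C (bernoulli k / (k.factorial : ℚ)) *
        (MvPolynomial.C (1 / ((2 * (m + 1) - 2 - k).factorial : ℚ)) *
          MvPolynomial.X 1 ^ (2 * (m + 1) - 2 - k)) *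
        (1 + MvPolynomial.C (2 / (2 * ((m + 1 : ℕ) : ℚ) - 1 - (k : ℚ))) * MvPolynomial.X 1) *
        MvPolynomial.X 0 ^ (m + 1 - 1 + k) : MvPolynomial (Fin 2) ℚ) =
      if k = 0 then 1 / ((2 * m).factorial : ℚ) * (2 / (2 * m + 1)) else 0 := by
    intro k
    obtain ⟨j, hj⟩ : ∃ j, 2 * (m + 1) - 2 - k = j := ⟨_, rfl⟩
    have expand : (MvPolynomial.C (bernoulli k / (k.factorial : ℚ)) *
        (MvPolynomial.C (1 / ((2 * (m + 1) - 2 - k).factorial : ℚ)) *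
          MvPolynomial.X 1 ^ (2 * (m + 1) - 2 - k)) *
        (1 + MvPolynomial.C (2 / (2 * ((m + 1 : ℕ) : ℚ) - 1 - (k : ℚ))) * MvPolynomial.X 1) *
        MvPolynomial.X 0 ^ (m + 1 - 1 + k) : MvPolynomial (Fin 2) ℚ) =
        MvPolynomial.C (bernoulli k / (k.factorial : ℚ) * (1 / (j.factorial : ℚ))) *
          MvPolynomial.X 0 ^ (m + k) * MvPolynomial.X 1 ^ j +
        MvPolynomial.C (bernoulli k / (k.factorial : ℚ) * (1 / (j.factorial : ℚ)) *
          (2 / (2 * ((m + 1 : ℕ) : ℚ) - 1 - (k : ℚ)))) *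
          MvPolynomial.X 0 ^ (m + k) * MvPolynomial.X 1 ^ (j + 1) := by
      rw [hj, show m + 1 - 1 + k = m + k by omega]
      simp only [map_mul]
      ring
    rw [expand, MvPolynomial.coeff_add, coeff_C_mul_X_pow_mul_X_pow,
      coeff_C_mul_X_pow_mul_X_pow, if_neg (by omega), zero_add]
    split_ifs with h1 h2 h2
    · subst h2
      have : j = 2 * m := by omega
      subst this
      simp only [bernoulli_zero, Nat.factorial_zero]
      push_cast
      ring
    · omega
    · omega
    · rfl
  rw [leadingPart, MvPolynomial.coeff_C_mul, MvPolynomial.coeff_sum,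
    Finset.sum_congr rfl fun k _ => hterm k, Finset.sum_ite_eq', if_pos (Finset.mem_range.2 (by omega))]
  positivity

theorem totalDegree_eq_of_sub_leadingPart {m : ℕ} {E : MvPolynomial (Fin 2) ℚ}
    (h : (E - leadingPart (m + 1)).totalDegree ≤ 3 * m) : E.totalDegree = 3 * m + 1 := by
  refine le_antisymm ?_ ?_
  · rw [← sub_add_cancel E (leadingPart (m + 1))]
    exact totalDegree_add_le_of_le (h.trans (by omega)) (totalDegree_leadingPart_le m)
  · have hs : (Finsupp.single 0 m + Finsupp.single 1 (2 * m + 1) : Fin 2 →₀ ℕ).sum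
        (fun _ e => e) = 3 * m + 1 := by
      rw [Finsupp.sum_fintype _ _ (fun _ => rfl), Fin.sum_univ_two]
      simp; omega
    have h0 : MvPolynomial.coeff (Finsupp.single 0 m + Finsupp.single 1 (2 * m + 1))
        (E - leadingPart (m + 1)) = 0 := by
      by_contra hne
      have := MvPolynomial.le_totalDegree (MvPolynomial.mem_support_iff.2 hne)
      omega
    rw [MvPolynomial.coeff_sub, sub_eq_zero] at h0
    have hne := coeff_leadingPart_ne_zero m
    rw [← h0] at hne
    have := MvPolynomial.le_totalDegree (MvPolynomial.mem_support_iff.2 hne)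
    omega

theorem givenByPolynomial_of_evalHalf {f : ℕ → ℕ → ℕ} {P : MvPolynomial (Fin 2) ℚ}
    (h : ∀ N c, c < N → (f (2 * N + 1) c : ℚ) = evalHalf P N c) :
    GivenByPolynomial f (shiftHalf P) := by
  intro p c hp hp5 hc
  obtain ⟨N, rfl⟩ := hp.odd_of_ne_two (by omega)
  rw [h N c (by omega), eval_shiftHalf]

theorem corollary2p6 (g : ℕ) (hg : 2 ≤ g) :
    ∃ E O D : MvPolynomial (Fin 2) ℚ,
      GivenByPolynomial (evenCount g) E ∧
      GivenByPolynomial (oddCount g) O ∧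
      GivenByPolynomial (totalCount g) D ∧
      E.totalDegree = 3 * g - 2 ∧
      O.totalDegree = 3 * g - 2 ∧
      (3 ≤ g →
        (E - leadingPart g).totalDegree ≤ 3 * g - 4 ∧
        (O - leadingPart g).totalDegree ≤ 3 * g - 4) ∧
      (MvPolynomial.C (1 / 2 : ℚ) * D - leadingPart g).totalDegree ≤ 3 * g - 4 := by
  obtain ⟨m, rfl⟩ : ∃ m, g = m + 1 := ⟨g - 1, by omega⟩
  obtain ⟨P, hP, hPdeg⟩ := exists_polynomial_totalSum m
  obtain ⟨Q, hQ, hQdeg⟩ := exists_polynomial_signedSum m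
  have hC : ∀ r : ℚ, shiftHalf (MvPolynomial.C r) = MvPolynomial.C r :=
    fun r => shiftHalf.commutes r
  have hD : (MvPolynomial.C (1 / 2 : ℚ) * shiftHalf P - leadingPart (m + 1)).totalDegree ≤
      3 * m - 1 := by
    have hsplit : MvPolynomial.C (1 / 2 : ℚ) * shiftHalf P - leadingPart (m + 1) =
        MvPolynomial.C (1 / 2) * shiftHalf (P - bernoulliPart m) +
        (MvPolynomial.C (1 / 2) * shiftHalf (bernoulliPart m) - leadingPart (m + 1)) := by
      rw [map_sub]; ring
    rw [hsplit]
    refine totalDegree_add_le_of_le (totalDegree_C_mul_le_of_le _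
      ((totalDegree_shiftHalf_le _).trans ?_))
      (totalDegree_shiftHalf_bernoulliPart_sub_le m (by omega))
    rcases hPdeg with rfl | h
    · simp
    · omega
  have hδ : (MvPolynomial.C (1 / 2 : ℚ) * shiftHalf Q).totalDegree ≤ 2 * m + 1 :=
    totalDegree_C_mul_le_of_le _ ((totalDegree_shiftHalf_le Q).trans hQdeg)
  have hE : ∀ d, 3 * m - 1 ≤ d → 2 * m + 1 ≤ d →
      (shiftHalf (MvPolynomial.C (1 / 2) * (P + Q)) - leadingPart (m + 1)).totalDegree ≤ d := by
    intro d h1 h2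
    rw [map_mul, hC, map_add, mul_add, add_sub_right_comm]
    exact totalDegree_add_le_of_le (hD.trans h1) (hδ.trans h2)
  have hO : ∀ d, 3 * m - 1 ≤ d → 2 * m + 1 ≤ d →
      (shiftHalf (MvPolynomial.C (1 / 2) * (P - Q)) - leadingPart (m + 1)).totalDegree ≤ d := by
    intro d h1 h2
    rw [map_mul, hC, map_sub, mul_sub, sub_right_comm]
    exact totalDegree_sub_le_of_le (hD.trans h1) (hδ.trans h2)
  have hcalc : ∀ R S : MvPolynomial (Fin 2) ℚ, ∀ N c, evalHalf (MvPolynomial.C (1 / 2) * (R + S))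
      N c = (evalHalf R N c + evalHalf S N c) / 2 := by
    intro R S N c
    simp only [evalHalf, map_mul, map_add, MvPolynomial.eval_C]; ring
  have hneg : ∀ N c, evalHalf (-Q) N c = -evalHalf Q N c := fun N c => by simp [evalHalf]
  refine ⟨shiftHalf (MvPolynomial.C (1 / 2) * (P + Q)),
    shiftHalf (MvPolynomial.C (1 / 2) * (P - Q)), shiftHalf P,
    givenByPolynomial_of_evalHalf fun N c hc => ?_,
    givenByPolynomial_of_evalHalf fun N c hc => ?_,
    givenByPolynomial_of_evalHalf fun N c hc => ?_, ?_, ?_, fun hg3 => ⟨?_, ?_⟩, ?_⟩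
  · rw [hcalc, hP N c hc, hQ N c hc, evenCount_eq]
  · rw [sub_eq_add_neg, hcalc, hneg, hP N c hc, hQ N c hc, oddCount_eq, sub_eq_add_neg]
  · rw [totalCount, Nat.cast_add, evenCount_eq, oddCount_eq, hP N c hc]; ring
  · exact totalDegree_eq_of_sub_leadingPart (hE _ (by omega) (by omega))
  · exact totalDegree_eq_of_sub_leadingPart (hO _ (by omega) (by omega))
  · exact hE _ (by omega) (by omega)
  · exact hO _ (by omega) (by omega)
  · exact hD.trans (by omega)
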